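/- For integers $m\ge 2s\ge 0$ and $n\ge m-s$, let $W_{n,m,s}$ be the graph on $n$ vertices whose vertex set is partitioned into sets $X,Y,Z$ with $|X|=s$, $|Y|=m-2s$, $|Z|=n-(m-s)$, and whose edges are all pairs of distinct vertices in $X\cup Y$ and all pairs consisting of a vertex of $X$ and a vertex of $Z$. For a finite simple graph $G$, let $\lambda(G)$ denote its spectral radius, i.e. the largest absolute value of an eigenvalue of its adjacency matrix. **Theorem.** Let $k\ge 2$ be an integer with $k\ne 3$, let $t=\lfloor k/2\rfloor-1$, and let $G$ be a graph on $n\ge 3k$ vertices. If $\lambda(G)\ge\lambda(W_{n,k-1,t})$, then $G$ contains a path on exactly $k$ vertices (as a not necessarily induced subgraph), unless $G\cong W_{n,k-1,t}$. -/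

import Mathlib

/-- The graph `W_{n,k,s}` on the vertex set `{0, …, n-1}`, with
`X = {i | i < s}`, `Y = {i | s ≤ i < k - s}` and `Z = {i | k - s ≤ i}`, so that `|X| = s`,
`|Y| = k - 2s` and `|Z| = n - (k - s)` whenever `2s ≤ k` and `k - s ≤ n`.
Its edges are all pairs inside `X ∪ Y` and all pairs between `X` and `Z`. -/
def graphW (n k s : ℕ) : SimpleGraph (Fin n) where
  Adj i j := i ≠ j ∧
    ((i.val < k - s ∧ j.val < k - s) ∨
      (i.val < s ∧ k - s ≤ j.val) ∨ (j.val < s ∧ k - s ≤ i.val))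
  symm := ⟨by
    rintro i j ⟨hij, h⟩
    exact ⟨hij.symm, by tauto⟩⟩
  loopless := ⟨fun _ h => h.1 rfl⟩

open Classical in
/-- The spectral radius `λ(G)` of a finite graph: the largest absolute value of an eigenvalue
of its adjacency matrix, as an extended nonnegative real. The adjacency matrix is real and
symmetric, so all its eigenvalues are real. -/
noncomputable def graphSpectralRadius {V : Type*} [Fintype V] (G : SimpleGraph V) : ENNReal :=
  spectralRadius ℝ (G.adjMatrix ℝ)

/-- `G` contains a path of order `k`, i.e. a path on exactly `k` vertices. -/
def ContainsPathOfOrder {V : Type*} (G : SimpleGraph V) (k : ℕ) : Prop :=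
  ∃ (u v : V) (p : G.Walk u v), p.IsPath ∧ p.support.length = k

/-! Put `m = k - 1`. Among the graphs without a path on `k` vertices, consider one of largest
leading eigenvalue `M`, with nonnegative leading eigenvector `x`. The Kelmans operation towards an
adjacent vertex with a larger entry creates no path on `k` vertices (`HasListPath.of_kelmans`) and
does not lower the quadratic form. Extremality therefore forces the closed neighbourhoods of
adjacent vertices to be nested (`adj_of_adj_of_le`), and some vertex is adjacent to all others
(`exists_dominating`). Sorted by decreasing entries of `x`, the graph becomes the comparability
graph of a rooted tree in which `upNbrs` lists the ancestors.

If, for every `s ≤ t`, the union `upCore G (s + 1)` of the root chains of vertices with more than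
`s` ancestors has at least `k - s` vertices, a path on `k` vertices can be assembled
(`IsNestedOrder.hasListPath`). So some core has at most `m - s` vertices, and a rearrangement
argument bounds the form of `G` at `x` by that of `graphW n m s` (`IsNestedOrder.adjForm_le`). The
dominating vertex excludes `s = 0`. If `0 < s < t`, explicit test weights put the form of `graphW n
m s` strictly below level `μ`, the leading eigenvalue of `graphW n m t`. Hence `s = t`, and equality
identifies the graph (`IsNestedOrder.eq_graphW`).

Applied to an extremal graph this gives `M ≤ μ`; so a path-free `G` with spectral radius at least
`μ` is itself extremal, and the same argument applies to it. For `k = 2` the graph `graphW` is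
edgeless and the claim is immediate. -/

/-- `G` has a path on `k` vertices, given as a list of distinct, consecutively adjacent vertices. -/
def HasListPath {V : Type*} (G : SimpleGraph V) (k : ℕ) : Prop :=
  ∃ l : List V, l.IsChain G.Adj ∧ l.Nodup ∧ l.length = k

theorem HasListPath.containsPathOfOrder {V : Type*} [Fintype V] {G : SimpleGraph V} {k : ℕ}
    (hk : k ≠ 0) (h : HasListPath G k) : ContainsPathOfOrder G k := by
  obtain ⟨l, hc, hn, hl⟩ := h
  have hne : l ≠ [] := by rintro rfl; exact hk hl.symm
  refine ⟨_, _, SimpleGraph.Walk.ofSupport l hne hc, ?_, ?_⟩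
  · rw [SimpleGraph.Walk.isPath_def, SimpleGraph.Walk.support_ofSupport]; exact hn
  · rw [SimpleGraph.Walk.support_ofSupport, hl]

theorem HasListPath.of_le {V : Type*} {G : SimpleGraph V} {k k' : ℕ} (h : HasListPath G k')
    (hk : k ≤ k') : HasListPath G k := by
  obtain ⟨l, hc, hn, hl⟩ := h
  exact ⟨l.take k, hc.take k, hn.sublist (List.take_sublist _ _), by simp [hl, hk]⟩

/-! ### The Kelmans operation and paths. -/

/-- The Kelmans operation from `u` to `v`: the edges from `u` to the vertices outside the closed
neighbourhood of `v` are moved to `v`. -/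
def kelmans {V : Type*} (G : SimpleGraph V) (u v : V) : SimpleGraph V where
  Adj a b := (G.Adj a b ∧ ¬ (a = u ∧ b ≠ v ∧ ¬ G.Adj v b) ∧ ¬ (b = u ∧ a ≠ v ∧ ¬ G.Adj v a)) ∨
    (a = v ∧ b ≠ v ∧ G.Adj u b ∧ ¬ G.Adj v b) ∨ (b = v ∧ a ≠ v ∧ G.Adj u a ∧ ¬ G.Adj v a)
  symm := ⟨by
    intro a b h
    rcases h with ⟨h, h1, h2⟩ | h | h
    · exact Or.inl ⟨h.symm, h2, h1⟩
    · exact Or.inr (Or.inr h)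
    · exact Or.inr (Or.inl h)⟩
  loopless := ⟨by
    intro a h
    rcases h with h | h | h
    · exact G.loopless.irrefl a h.1
    · exact h.2.1 h.1
    · exact h.2.1 h.1⟩

section Kelmans

variable {V : Type*} {G : SimpleGraph V} {u v : V}

theorem kelmans_adj_of_ne {a b : V} (ha : a ≠ v) (hb : b ≠ v) (h : (kelmans G u v).Adj a b) :
    G.Adj a b := by
  rcases h with h | h | h
  · exact h.1
  · exact absurd h.1 ha
  · exact absurd h.1 hb

theorem kelmans_adj_target {a : V} (h : (kelmans G u v).Adj v a) : G.Adj v a ∨ G.Adj u a := by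
  rcases h with h | h | h
  · exact Or.inl h.1
  · exact Or.inr h.2.2.1
  · exact absurd rfl h.2.1

theorem kelmans_adj_source (huv : u ≠ v) {a : V} (hav : a ≠ v)
    (h : (kelmans G u v).Adj u a) : G.Adj v a := by
  rcases h with h | h | h
  · by_contra h'
    exact h.2.1 ⟨rfl, hav, h'⟩
  · exact absurd h.1 huv
  · exact absurd h.1 hav

theorem isChain_of_kelmans {l : List V} (hv : v ∉ l) (h : l.IsChain (kelmans G u v).Adj) :
    l.IsChain G.Adj :=
  h.imp_of_mem_imp fun a b ha hb hab =>
    kelmans_adj_of_ne (fun e => hv (by rwa [← e])) (fun e => hv (by rwa [← e])) hab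

/-- After the operation every neighbour of `u` other than `v` is a neighbour of `v` in `G`, so off
`v` the vertex `u` can be renamed `v`. -/
theorem isChain_map_swap_of_kelmans [DecidableEq V] (huv : u ≠ v) {l : List V} (hv : v ∉ l)
    (h : l.IsChain (kelmans G u v).Adj) : (l.map (Equiv.swap u v)).IsChain G.Adj := by
  rw [List.isChain_map]
  refine h.imp_of_mem_imp fun a b ha hb hab => ?_
  have hav : a ≠ v := fun e => hv (by rwa [← e])
  have hbv : b ≠ v := fun e => hv (by rwa [← e])
  by_cases hau : a = u
  · subst hau
    have hba : b ≠ a := hab.ne'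
    rw [Equiv.swap_apply_left, Equiv.swap_apply_of_ne_of_ne hba hbv]
    exact kelmans_adj_source huv hbv hab
  by_cases hbu : b = u
  · subst hbu
    rw [Equiv.swap_apply_left, Equiv.swap_apply_of_ne_of_ne hau hav]
    exact (kelmans_adj_source huv hav hab.symm).symm
  rw [Equiv.swap_apply_of_ne_of_ne hau hav, Equiv.swap_apply_of_ne_of_ne hbu hbv]
  exact kelmans_adj_of_ne hav hbv hab

theorem isChain_adj_reverse {l : List V} :
    l.reverse.IsChain G.Adj ↔ l.IsChain G.Adj := by
  rw [List.isChain_reverse]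
  simp only [G.adj_comm]

theorem isChain_cons_of_kelmans (huv : u ≠ v) {l : List V} (hv : v ∉ l)
    (h : (u :: l).IsChain (kelmans G u v).Adj) : (v :: l).IsChain G.Adj := by
  rw [List.isChain_cons] at h ⊢
  refine ⟨fun y hy => ?_, isChain_of_kelmans hv h.2⟩
  exact kelmans_adj_source huv (fun e => hv (e ▸ List.mem_of_mem_head? hy)) (h.1 y hy)

/-- The hard case of `HasListPath.of_kelmans`: in `G`, `x` hangs on `u` and `y` hangs on `v`. Since
the remaining neighbours of `u` other than `v` are neighbours of `v` in `G`, reversing a stretch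
between `u` and the crossing repairs the path when `u` lies on it. Otherwise `u` is inserted between
`x` and `v`, and the longer path is truncated. -/
theorem hasListPath_of_kelmans_crossing (huv : G.Adj u v) {x y : V} {A B : List V}
    (hc : (A ++ x :: v :: y :: B).IsChain (kelmans G u v).Adj)
    (hn : (A ++ x :: v :: y :: B).Nodup) (hx : G.Adj u x) (hy : G.Adj v y) (hyu : y ≠ u) :
    HasListPath G (A ++ x :: v :: y :: B).length := by
  classical
  have hxu : x ≠ u := hx.ne'
  rw [List.isChain_append_cons_cons, List.isChain_cons_cons] at hc
  obtain ⟨hcA, -, -, hcB⟩ := hc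
  have hvA : v ∉ A ++ [x] := by grind
  have hvB : v ∉ y :: B := by grind
  have hcA' := isChain_of_kelmans hvA hcA
  have hcB' := isChain_of_kelmans hvB hcB
  by_cases huA : u ∈ A
  · obtain ⟨A₁, A₂, rfl⟩ := List.append_of_mem huA
    refine ⟨A₁ ++ u :: x :: (A₂.reverse ++ v :: y :: B), ?_, ?_, ?_⟩
    · rw [List.append_assoc, List.cons_append, List.isChain_split] at hcA hcA'
      have h1 := isChain_cons_of_kelmans huv.ne (by grind) hcA.2
      rw [List.isChain_append_cons_cons]
      refine ⟨hcA'.1, hx, ?_⟩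
      rw [← List.cons_append, List.isChain_append_cons_cons]
      refine ⟨?_, hy, hcB'⟩
      rw [← isChain_adj_reverse]
      simpa using h1
    · have : (A₁ ++ u :: x :: (A₂.reverse ++ v :: y :: B)).Perm
          (A₁ ++ u :: A₂ ++ x :: v :: y :: B) := by
        rw [List.append_assoc]
        refine List.Perm.append_left _ ?_
        refine List.Perm.cons _ ?_
        exact (((List.reverse_perm A₂).append_right _).cons x).trans List.perm_middle.symm
      exact this.nodup_iff.2 hn
    · simp; omega
  by_cases huB : u ∈ B
  · obtain ⟨B₁, B₂, rfl⟩ := List.append_of_mem huB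
    refine ⟨A ++ x :: u :: (B₁.reverse ++ y :: v :: B₂), ?_, ?_, ?_⟩
    · rw [← List.cons_append, List.isChain_split] at hcB hcB'
      have h1 := isChain_cons_of_kelmans huv.ne (by grind) hcB.2
      rw [List.isChain_append_cons_cons]
      refine ⟨hcA', hx.symm, ?_⟩
      rw [← List.cons_append, List.isChain_append_cons_cons]
      refine ⟨?_, hy.symm, h1⟩
      rw [← isChain_adj_reverse]
      simpa using hcB'.1
    · have : (A ++ x :: u :: (B₁.reverse ++ y :: v :: B₂)).Perm
          (A ++ x :: v :: y :: (B₁ ++ u :: B₂)) := by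
        refine List.Perm.append_left _ (List.Perm.cons _ ?_)
        have h1 : (B₁.reverse ++ y :: v :: B₂).Perm (y :: v :: (B₁ ++ B₂)) :=
          List.perm_middle.trans ((List.perm_middle.trans
            (((List.reverse_perm B₁).append_right _).cons v)).cons y)
        refine (h1.cons u).trans ?_
        refine List.Perm.trans ?_ ((List.perm_middle.symm.cons y).cons v)
        refine (List.Perm.swap y u _).trans ?_
        refine ((List.Perm.swap v u _).cons y).trans ?_
        exact List.Perm.swap v y _
      exact this.nodup_iff.2 hn
    · simp; omega
  refine HasListPath.of_le (k' := (A ++ x :: u :: v :: y :: B).length) ?_ (by simp)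
  refine ⟨A ++ x :: u :: v :: y :: B, ?_, ?_, rfl⟩
  · rw [List.isChain_append_cons_cons, List.isChain_cons_cons, List.isChain_cons_cons]
    exact ⟨hcA', hx.symm, huv, hy, hcB'⟩
  · have : (A ++ x :: u :: v :: y :: B).Perm (u :: (A ++ x :: v :: y :: B)) :=
      ((List.Perm.swap u x _).append_left A).trans List.perm_middle
    rw [this.nodup_iff, List.nodup_cons]
    refine ⟨?_, hn⟩
    have := huv.ne
    grind

/-- If both path neighbours of `v` are adjacent to `v` in `G`, the path survives. If both lie in the
closed neighbourhood of `u`, exchanging `u` and `v` gives a path of `G`. Otherwise one is served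
only by `u` and the other only by `v`, which up to reversal is the crossing case; this needs `v` to
be an inner vertex of the path. -/
theorem HasListPath.of_kelmans {k : ℕ} (huv : G.Adj u v) (h : HasListPath (kelmans G u v) k) :
    HasListPath G k := by
  classical
  obtain ⟨l, hc, hn, rfl⟩ := h
  by_cases hv : v ∈ l
  swap
  · exact ⟨l, isChain_of_kelmans hv hc, hn, rfl⟩
  obtain ⟨A, B, rfl⟩ := List.append_of_mem hv
  have hvA : v ∉ A := by grind
  have hvB : v ∉ B := by grind
  have hchain : ∀ w : V, ∀ A' B' : List V, A'.IsChain G.Adj → B'.IsChain G.Adj →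
      (∀ x ∈ A'.getLast?, G.Adj w x) → (∀ y ∈ B'.head?, G.Adj w y) →
      (A' ++ w :: B').IsChain G.Adj := by
    intro w A' B' hA hB hx hy
    refine hA.append (List.isChain_cons.2 ⟨hy, hB⟩) fun x hx' y hy' => ?_
    obtain rfl : w = y := by simpa using hy'
    exact (hx x hx').symm
  have hcA := hc.left_of_append
  have hcB := (List.isChain_cons.1 hc.right_of_append).2
  have hx : ∀ x ∈ A.getLast?, (kelmans G u v).Adj v x := fun x hx =>
    ((List.isChain_append.1 hc).2.2 x hx v (by simp)).symm
  have hy : ∀ y ∈ B.head?, (kelmans G u v).Adj v y :=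
    (List.isChain_cons.1 hc.right_of_append).1
  by_cases h1 : (∀ x ∈ A.getLast?, G.Adj v x) ∧ (∀ y ∈ B.head?, G.Adj v y)
  · exact ⟨_, hchain v A B (isChain_of_kelmans hvA hcA) (isChain_of_kelmans hvB hcB) h1.1 h1.2,
      hn, rfl⟩
  by_cases h2 : (∀ x ∈ A.getLast?, x = u ∨ G.Adj u x) ∧ (∀ y ∈ B.head?, y = u ∨ G.Adj u y)
  · have hswap : ∀ z, z ≠ v → z = u ∨ G.Adj u z → G.Adj u (Equiv.swap u v z) := by
      rintro z hz (rfl | h)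
      · simpa using huv
      · rwa [Equiv.swap_apply_of_ne_of_ne h.ne' hz]
    refine ⟨(A ++ v :: B).map (Equiv.swap u v), ?_, hn.map (Equiv.injective _), by simp⟩
    rw [List.map_append, List.map_cons, Equiv.swap_apply_right]
    refine hchain u _ _ (isChain_map_swap_of_kelmans huv.ne hvA hcA)
      (isChain_map_swap_of_kelmans huv.ne hvB hcB) ?_ ?_
    · intro x hx'
      simp only [List.getLast?_map, Option.mem_def, Option.map_eq_some_iff] at hx'
      obtain ⟨z, hz, rfl⟩ := hx'
      exact hswap z (fun e => hvA (e ▸ List.mem_of_mem_getLast? hz)) (h2.1 z hz)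
    · intro x hx'
      simp only [List.head?_map, Option.mem_def, Option.map_eq_some_iff] at hx'
      obtain ⟨z, hz, rfl⟩ := hx'
      exact hswap z (fun e => hvB (e ▸ List.mem_of_mem_head? hz)) (h2.2 z hz)
  have hvu : ∀ z, (kelmans G u v).Adj v z → ¬ G.Adj v z → G.Adj u z := fun z hz h =>
    (kelmans_adj_target hz).resolve_left h
  rcases List.eq_nil_or_concat A with rfl | ⟨A, x, rfl⟩
  · simp only [List.getLast?_nil, Option.mem_def, reduceCtorEq, false_implies, implies_true,
      true_and] at h1 h2
    push Not at h1 h2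
    obtain ⟨y, hyB, h1⟩ := h1
    obtain ⟨y', hyB', h2⟩ := h2
    obtain rfl : y = y' := by simpa [hyB] using hyB'
    exact absurd (hvu y (hy y hyB) h1) h2.2
  rcases B with _ | ⟨y, B⟩
  · simp only [List.head?_nil, Option.mem_def, reduceCtorEq, false_implies, implies_true,
      and_true] at h1 h2
    push Not at h1 h2
    obtain ⟨y, hyB, h1⟩ := h1
    obtain ⟨y', hyB', h2⟩ := h2
    obtain rfl : y = y' := by rw [hyB] at hyB'; simpa using hyB'
    exact absurd (hvu y (hx y hyB) h1) h2.2
  have hx := hx x (by simp)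
  have hy := hy y (by simp)
  simp only [List.concat_eq_append, List.getLast?_append, List.getLast?_singleton, Option.some_or,
    Option.mem_def, Option.some.injEq, forall_eq', List.head?_cons] at h1 h2
  have hform : A.concat x ++ v :: y :: B = A ++ x :: v :: y :: B := by simp
  rw [hform] at hc hn ⊢
  by_cases h3 : G.Adj v x
  · have h4 : ¬ G.Adj v y := fun h => h1 ⟨h3, h⟩
    have h5 := hvu y hy h4
    have h6 : ¬ (x = u ∨ G.Adj u x) := fun h => h2 ⟨h, Or.inr h5⟩
    have hrev : (A ++ x :: v :: y :: B).reverse = B.reverse ++ y :: v :: x :: A.reverse := by simp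
    rw [← List.length_reverse, hrev]
    refine hasListPath_of_kelmans_crossing huv ?_ ?_ h5 h3 fun h => h6 (Or.inl h)
    · rw [← hrev, isChain_adj_reverse]; exact hc
    · rw [← hrev, List.nodup_reverse]; exact hn
  · have h5 := hvu x hx h3
    have h6 : ¬ (y = u ∨ G.Adj u y) := fun h => h2 ⟨Or.inr h5, h⟩
    have h7 : G.Adj v y := by
      by_contra h
      exact h6 (Or.inr (hvu y hy h))
    exact hasListPath_of_kelmans_crossing huv hc hn h5 h7 fun h => h6 (Or.inl h)

end Kelmans

/-! ### The adjacency quadratic form and the spectral radius. -/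

open Classical in
/-- The value at `i` of the adjacency operator of `G` applied to the weights `x`. -/
noncomputable def nbrSum {V : Type*} [Fintype V] (G : SimpleGraph V) (x : V → ℝ) (i : V) : ℝ :=
  ∑ j, if G.Adj i j then x j else 0

/-- The quadratic form of the adjacency matrix of `G`. -/
noncomputable def adjForm {V : Type*} [Fintype V] (G : SimpleGraph V) (x : V → ℝ) : ℝ :=
  ∑ i, x i * nbrSum G x i

section Form

variable {V : Type*} [Fintype V] {G H : SimpleGraph V} {x y : V → ℝ} {M : ℝ}

open Classical in
theorem adjForm_eq_sum : adjForm G x = ∑ i, ∑ j, if G.Adj i j then x i * x j else 0 := by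
  simp only [adjForm, nbrSum, Finset.mul_sum, mul_ite, mul_zero]

theorem nbrSum_add (i : V) : nbrSum G (x + y) i = nbrSum G x i + nbrSum G y i := by
  simp only [nbrSum, ← Finset.sum_add_distrib]
  refine Finset.sum_congr rfl fun j _ => ?_
  split_ifs <;> simp

theorem nbrSum_smul (c : ℝ) (i : V) : nbrSum G (c • x) i = c * nbrSum G x i := by
  simp only [nbrSum, Finset.mul_sum]
  refine Finset.sum_congr rfl fun j _ => ?_
  split_ifs <;> simp

theorem sum_mul_nbrSum_comm : ∑ i, x i * nbrSum G y i = ∑ i, y i * nbrSum G x i := by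
  classical
  simp only [nbrSum, Finset.mul_sum]
  rw [Finset.sum_comm]
  refine Finset.sum_congr rfl fun j _ => Finset.sum_congr rfl fun i _ => ?_
  simp only [G.adj_comm i j]
  split_ifs <;> ring

theorem adjForm_add :
    adjForm G (x + y) = adjForm G x + 2 * ∑ i, y i * nbrSum G x i + adjForm G y := by
  have h : ∑ i, x i * nbrSum G y i = ∑ i, y i * nbrSum G x i := sum_mul_nbrSum_comm
  simp only [adjForm, nbrSum_add, Pi.add_apply, mul_add, add_mul, Finset.sum_add_distrib, h]
  ring

theorem adjForm_smul (c : ℝ) : adjForm G (c • x) = c ^ 2 * adjForm G x := by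
  simp only [adjForm, nbrSum_smul, Finset.mul_sum, Pi.smul_apply, smul_eq_mul]
  exact Finset.sum_congr rfl fun i _ => by ring

theorem le_nbrSum (hx : ∀ i, 0 ≤ x i) {i j : V} (h : G.Adj i j) : x j ≤ nbrSum G x i := by
  classical
  have := Finset.single_le_sum (f := fun j => if G.Adj i j then x j else 0)
    (fun j _ => by split_ifs; exacts [hx j, le_rfl]) (Finset.mem_univ j)
  simpa [h, nbrSum] using this

/-- A vector attaining the maximum of the Rayleigh quotient is an eigenvector. -/
theorem nbrSum_eq_of_adjForm_max (hM : ∀ z : V → ℝ, adjForm G z ≤ M * ∑ i, z i ^ 2)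
    (hx : M * ∑ i, x i ^ 2 ≤ adjForm G x) (i : V) : nbrSum G x i = M * x i := by
  classical
  -- First variation along coordinate `i`; since there are no loops, the form contributes no `ε ^ 2`
  -- term.
  have key : ∀ ε : ℝ, 2 * ε * (nbrSum G x i - M * x i) ≤ M * ε ^ 2 := by
    intro ε
    have h := hM (x + Pi.single i ε)
    have h1 : adjForm G (Pi.single i ε) = 0 := by
      rw [adjForm_eq_sum]
      refine Finset.sum_eq_zero fun a _ => Finset.sum_eq_zero fun b _ => ?_
      split_ifs with hab
      · rcases eq_or_ne a i with rfl | ha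
        · simp [Pi.single_eq_of_ne hab.ne']
        · simp [Pi.single_eq_of_ne ha]
      · rfl
    have h2 : ∑ j, (Pi.single i ε : V → ℝ) j * nbrSum G x j = ε * nbrSum G x i := by
      rw [Finset.sum_eq_single i] <;> simp +contextual [Pi.single_eq_of_ne]
    have h3 : ∑ j, (x + (Pi.single i ε : V → ℝ)) j ^ 2 = ∑ j, x j ^ 2 + 2 * ε * x i + ε ^ 2 := by
      simp only [Pi.add_apply, add_sq, Finset.sum_add_distrib]
      congr 1
      · congr 1
        rw [Finset.sum_eq_single i] <;> simp +contextual [Pi.single_eq_of_ne]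
        ring
      · rw [Finset.sum_eq_single i] <;> simp +contextual [Pi.single_eq_of_ne]
    rw [adjForm_add, h1, h2, h3] at h
    nlinarith
  set d := nbrSum G x i - M * x i with hd
  have hpos : 0 < |M| + 1 := by positivity
  -- With this small `ε` the linear gain beats the quadratic cost unless `d = 0`.
  have h := key (d / (|M| + 1))
  have h4 : d ^ 2 * (2 * (|M| + 1)) ≤ d ^ 2 * M := by
    have h5 : 2 * (d / (|M| + 1)) * d = d ^ 2 * (2 * (|M| + 1)) / (|M| + 1) ^ 2 := by
      field_simp
    have h6 : M * (d / (|M| + 1)) ^ 2 = d ^ 2 * M / (|M| + 1) ^ 2 := by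
      field_simp
    rw [h5, h6] at h
    exact (div_le_div_iff_of_pos_right (by positivity)).1 h
  have h7 : d ^ 2 ≤ 0 := by nlinarith [le_abs_self M, abs_nonneg M, sq_nonneg d]
  have h8 : d = 0 := by nlinarith [sq_nonneg d]
  linarith

theorem adjForm_eq_of_nbrSum (h : ∀ i, nbrSum G x i = M * x i) :
    adjForm G x = M * ∑ i, x i ^ 2 := by
  rw [adjForm, Finset.mul_sum]
  exact Finset.sum_congr rfl fun i _ => by rw [h]; ring

theorem adjForm_le_abs : |adjForm G x| ≤ adjForm G |x| := by
  rw [adjForm_eq_sum, adjForm_eq_sum]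
  refine (Finset.abs_sum_le_sum_abs _ _).trans (Finset.sum_le_sum fun i _ => ?_)
  refine (Finset.abs_sum_le_sum_abs _ _).trans (Finset.sum_le_sum fun j _ => ?_)
  split_ifs <;> simp [abs_mul]

/-- Compactness of the unit sphere gives a maximiser, and replacing it by its absolute value does
not lower the form. -/
theorem exists_adjForm_max (G : SimpleGraph V) [Nonempty V] :
    ∃ (M : ℝ) (x : V → ℝ), x ≠ 0 ∧ (∀ i, 0 ≤ x i) ∧ adjForm G x = M * ∑ i, x i ^ 2 ∧
      ∀ z : V → ℝ, adjForm G z ≤ M * ∑ i, z i ^ 2 := by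
  classical
  let S : Set (V → ℝ) := {x | ∑ i, x i ^ 2 = 1}
  have hclosed : IsClosed S := isClosed_eq (by fun_prop) continuous_const
  have hbdd : S ⊆ Metric.closedBall 0 1 := by
    intro x hx
    rw [mem_closedBall_zero_iff, pi_norm_le_iff_of_nonneg zero_le_one]
    intro i
    rw [Real.norm_eq_abs, ← sq_le_one_iff_abs_le_one]
    rw [← (show ∑ i, x i ^ 2 = 1 from hx)]
    exact Finset.single_le_sum (f := fun i => x i ^ 2) (fun j _ => sq_nonneg _)
      (Finset.mem_univ i)
  have hcomp : IsCompact S := (isCompact_closedBall 0 1).of_isClosed_subset hclosed hbdd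
  have hne : S.Nonempty := by
    obtain ⟨i⟩ := ‹Nonempty V›
    refine ⟨Pi.single i 1, ?_⟩
    change ∑ j, (Pi.single i 1 : V → ℝ) j ^ 2 = 1
    rw [Finset.sum_eq_single i] <;> simp +contextual [Pi.single_eq_of_ne]
  have hcont : Continuous (adjForm G) := by
    have : adjForm G = fun x => ∑ i, ∑ j, if G.Adj i j then x i * x j else 0 :=
      funext fun x => adjForm_eq_sum
    rw [this]
    refine continuous_finsetSum _ fun i _ => continuous_finsetSum _ fun j _ => ?_
    split_ifs <;> fun_prop
  obtain ⟨x, hxS, hxmax⟩ := hcomp.exists_isMaxOn hne hcont.continuousOn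
  have hle : ∀ z : V → ℝ, adjForm G z ≤ adjForm G x * ∑ i, z i ^ 2 := by
    intro z
    rcases eq_or_ne z 0 with rfl | hz
    · simp [adjForm]
    have hpos : 0 < ∑ i, z i ^ 2 := by
      obtain ⟨i, hi⟩ := Function.ne_iff.1 hz
      exact Finset.sum_pos' (fun j _ => sq_nonneg _) ⟨i, Finset.mem_univ _, by
        have : z i ≠ 0 := hi
        positivity⟩
    set c := Real.sqrt (∑ i, z i ^ 2)
    have hc : c ^ 2 = ∑ i, z i ^ 2 := Real.sq_sqrt hpos.le
    have hc0 : c ≠ 0 := (Real.sqrt_pos.2 hpos).ne'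
    have hmem : c⁻¹ • z ∈ S := by
      change ∑ i, (c⁻¹ • z) i ^ 2 = 1
      simp only [Pi.smul_apply, smul_eq_mul, mul_pow, ← Finset.mul_sum, ← hc]
      field_simp
    have h := hxmax hmem
    simp only [Set.mem_ofPred_eq, adjForm_smul] at h
    rw [← hc]
    calc adjForm G z = (c⁻¹ ^ 2 * adjForm G z) * c ^ 2 := by field_simp
      _ ≤ _ := mul_le_mul_of_nonneg_right h (sq_nonneg c)
  have habs : ∑ i, |x| i ^ 2 = 1 := by
    simp only [Pi.abs_apply, sq_abs]
    exact hxS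
  have hxle : adjForm G x ≤ adjForm G |x| := (le_abs_self _).trans adjForm_le_abs
  refine ⟨adjForm G x, |x|, ?_, fun i => abs_nonneg _, ?_, hle⟩
  · intro h
    rw [h] at habs
    simp at habs
  · refine le_antisymm (hle _) ?_
    rw [habs, mul_one]
    exact hxle

theorem adjMatrix_mulVec_eq_nbrSum [DecidableRel G.Adj] (i : V) :
    (G.adjMatrix ℝ).mulVec x i = nbrSum G x i := by
  classical
  rw [SimpleGraph.adjMatrix_mulVec_apply, nbrSum]
  trans ∑ j, if j ∈ G.neighborFinset i then x j else 0
  · simp only [Finset.sum_ite_mem, Finset.univ_inter]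
  · refine Finset.sum_congr rfl fun j _ => ?_
    by_cases hj : G.Adj i j <;> simp [hj]

theorem mem_spectrum_adjMatrix_iff [DecidableEq V] [DecidableRel G.Adj] {ν : ℝ} :
    ν ∈ spectrum ℝ (G.adjMatrix ℝ) ↔ ∃ z : V → ℝ, z ≠ 0 ∧ ∀ i, nbrSum G z i = ν * z i := by
  rw [← Matrix.spectrum_toLin', ← Module.End.hasEigenvalue_iff_mem_spectrum]
  constructor
  · intro h
    obtain ⟨z, hz⟩ := h.exists_hasEigenvector
    refine ⟨z, hz.2, fun i => ?_⟩
    have := congrFun hz.apply_eq_smul i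
    rwa [Matrix.toLin'_apply, adjMatrix_mulVec_eq_nbrSum] at this
  · rintro ⟨z, hz, h⟩
    refine Module.End.hasEigenvalue_of_hasEigenvector (x := z) ⟨?_, hz⟩
    rw [Module.End.mem_eigenspace_iff]
    funext i
    rw [Matrix.toLin'_apply, adjMatrix_mulVec_eq_nbrSum, h]
    rfl

theorem graphSpectralRadius_le (hM : ∀ z : V → ℝ, adjForm G z ≤ M * ∑ i, z i ^ 2) :
    graphSpectralRadius G ≤ ENNReal.ofReal M := by
  classical
  unfold graphSpectralRadius spectralRadius
  refine iSup₂_le fun ν hν => ?_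
  obtain ⟨z, hz, h⟩ := mem_spectrum_adjMatrix_iff.1 hν
  have h1 := adjForm_eq_of_nbrSum h
  have h2 := (adjForm_le_abs (G := G) (x := z)).trans (hM _)
  have hpos : 0 < ∑ i, z i ^ 2 := by
    obtain ⟨i, hi⟩ := Function.ne_iff.1 hz
    exact Finset.sum_pos' (fun j _ => sq_nonneg _) ⟨i, Finset.mem_univ _, by
      have : z i ≠ 0 := hi
      positivity⟩
  rw [h1, abs_mul, abs_of_pos hpos] at h2
  simp only [Pi.abs_apply, sq_abs] at h2
  have h3 := le_of_mul_le_mul_right h2 hpos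
  rw [ENNReal.le_ofReal_iff_toReal_le (by simp) ((abs_nonneg _).trans h3)]
  simpa using h3

theorem le_graphSpectralRadius (hy : y ≠ 0) (h : ∀ i, nbrSum G y i = M * y i) :
    ENNReal.ofReal M ≤ graphSpectralRadius G := by
  classical
  have hmem : M ∈ spectrum ℝ (G.adjMatrix ℝ) := mem_spectrum_adjMatrix_iff.2 ⟨y, hy, h⟩
  have h1 : (‖M‖₊ : ENNReal) ≤ graphSpectralRadius G := by
    unfold graphSpectralRadius spectralRadius
    exact le_iSup₂ (f := fun (k : ℝ) (_ : k ∈ spectrum ℝ (G.adjMatrix ℝ)) => (‖k‖₊ : ENNReal))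
      M (by convert hmem)
  refine le_trans ?_ h1
  refine (ENNReal.ofReal_le_ofReal (le_abs_self M)).trans ?_
  rw [← Real.norm_eq_abs, ofReal_norm]
  rfl

end Form

/-! ### Attaching a pendant vertex. -/

section Pendant

variable {V : Type*} {G : SimpleGraph V} {v w : V} {k : ℕ}

/-- The graph obtained from `G` by keeping only the edges inside `C` and adding the edge `vw`. -/
def pendantGraph (G : SimpleGraph V) (C : Set V) (v w : V) (hvw : v ≠ w) : SimpleGraph V where
  Adj a b := (G.Adj a b ∧ a ∈ C ∧ b ∈ C) ∨ (a = v ∧ b = w) ∨ (a = w ∧ b = v)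
  symm := ⟨by
    rintro a b (h | h | h)
    · exact Or.inl ⟨h.1.symm, h.2.2, h.2.1⟩
    · exact Or.inr (Or.inr ⟨h.2, h.1⟩)
    · exact Or.inr (Or.inl ⟨h.2, h.1⟩)⟩
  loopless := ⟨by
    rintro a (h | h | h)
    · exact h.1.ne rfl
    · exact hvw (h.1.symm.trans h.2)
    · exact hvw (h.2.symm.trans h.1)⟩

/-- A path through `w` on at most `|C|` vertices misses some `u ∈ C`. The only neighbour of `w` is
`v`, which is adjacent to `u` as well, so `u` can replace `w`. -/
theorem HasListPath.of_pendantGraph {C : Finset V} (hvw : v ≠ w) (hw : w ∉ C)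
    (hC : ∀ a ∈ C, a ≠ v → G.Adj v a) (hv : v ∈ C) (hk : k ≤ C.card)
    (h : HasListPath (pendantGraph G C v w hvw) k) : HasListPath G k := by
  classical
  obtain ⟨l, hc, hn, rfl⟩ := h
  by_cases hwl : w ∈ l
  swap
  · refine ⟨l, hc.imp_of_mem_imp fun a b ha hb hab => ?_, hn, rfl⟩
    rcases hab with h | h | h
    · exact h.1
    · exact absurd hb (h.2 ▸ hwl)
    · exact absurd ha (h.1 ▸ hwl)
  obtain ⟨u, huC, hul⟩ : ∃ u ∈ C, u ∉ l := by
    by_contra! hall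
    have hsub : insert w C ⊆ l.toFinset := by
      intro a ha
      rcases Finset.mem_insert.1 ha with rfl | ha
      · simpa using hwl
      · simpa using hall a ha
    have := Finset.card_le_card hsub
    rw [Finset.card_insert_of_notMem hw, List.toFinset_card_of_nodup hn] at this
    omega
  have huw : u ≠ w := fun h => hw (h ▸ huC)
  refine ⟨l.map (Equiv.swap w u), ?_, hn.map (Equiv.injective _), by simp⟩
  rw [List.isChain_map]
  refine hc.imp_of_mem_imp fun a b ha hb hab => ?_
  have hau : a ≠ u := fun h => hul (h ▸ ha)
  have hbu : b ≠ u := fun h => hul (h ▸ hb)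
  have key : ∀ b, b = w → v ∈ l → G.Adj v (Equiv.swap w u b) := by
    rintro b rfl hvl
    rw [Equiv.swap_apply_left]
    exact hC u huC fun h => hul (h ▸ hvl)
  rcases hab with ⟨h, ha', hb'⟩ | ⟨rfl, h⟩ | ⟨h, rfl⟩
  · have haw : a ≠ w := fun h => hw (h ▸ ha')
    have hbw : b ≠ w := fun h => hw (h ▸ hb')
    rwa [Equiv.swap_apply_of_ne_of_ne haw hau, Equiv.swap_apply_of_ne_of_ne hbw hbu]
  · rw [Equiv.swap_apply_of_ne_of_ne hvw hau]
    exact key b h ha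
  · rw [Equiv.swap_apply_of_ne_of_ne hvw hbu]
    exact (key a h hb).symm

end Pendant

/-! ### Structure of extremal graphs. -/

section Extremal

variable {V : Type*} [Fintype V] {G H : SimpleGraph V} {x : V → ℝ} {M : ℝ} {u v : V} {k : ℕ}

theorem adjForm_mono (hx : ∀ i, 0 ≤ x i)
    (h : ∀ a b, G.Adj a b → x a ≠ 0 → x b ≠ 0 → H.Adj a b) : adjForm G x ≤ adjForm H x := by
  rw [adjForm_eq_sum, adjForm_eq_sum]
  refine Finset.sum_le_sum fun a _ => Finset.sum_le_sum fun b _ => ?_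
  have hab := mul_nonneg (hx a) (hx b)
  split_ifs with h1 h2 h2
  · exact le_rfl
  · by_cases ha : x a = 0
    · simp [ha]
    by_cases hb : x b = 0
    · simp [hb]
    exact absurd (h a b h1 ha hb) h2
  · exact hab
  · exact le_rfl

-- Each neighbour `w` moved from `u` to `v` changes the form by `2 * x w * (x v - x u)`.
open Classical in
theorem adjForm_kelmans (huv : G.Adj u v) :
    adjForm (kelmans G u v) x = adjForm G x + 2 * ((x v - x u) *
      ∑ w, if w ≠ v ∧ G.Adj u w ∧ ¬ G.Adj v w then x w else 0) := by
  set P : V → Prop := fun w => w ≠ v ∧ G.Adj u w ∧ ¬ G.Adj v w with hP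
  have hpt : ∀ a b, (if (kelmans G u v).Adj a b then x a * x b else 0) =
      (if G.Adj a b then x a * x b else 0) + (if a = v then (if P b then x v * x b else 0) else 0)
      + (if b = v then (if P a then x v * x a else 0) else 0)
      - (if a = u then (if P b then x u * x b else 0) else 0)
      - (if b = u then (if P a then x u * x a else 0) else 0) := by
    intro a b
    have hvu := huv.symm
    have h1 := huv.ne
    have hirr : ∀ a, ¬ G.Adj a a := G.loopless.irrefl
    have hs : ∀ a b, G.Adj a b → G.Adj b a := fun a b h => h.symm
    simp only [kelmans, hP]
    by_cases hau : a = u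
    · subst hau
      by_cases hbv : b = v
      · subst hbv; simp [huv, h1.symm]
      · by_cases hba : b = a
        · subst hba; simp [h1]
        · by_cases hab : G.Adj a b <;> by_cases hvb : G.Adj v b <;> simp [*] 
    by_cases hav : a = v
    · subst hav
      by_cases hbu : b = u
      · subst hbu; simp [hvu, h1, h1.symm]
      · by_cases hba : b = a
        · subst hba; simp [h1]
        · by_cases hab : G.Adj a b <;> by_cases hvb : G.Adj u b <;> simp [*]
    by_cases hbu : b = u
    · subst hbu
      have := G.adj_comm a b
      by_cases hab : G.Adj a b <;> by_cases hvb : G.Adj v a <;>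
        simp [*] at * <;> simp [*] <;> ring
    by_cases hbv : b = v
    · subst hbv
      have := G.adj_comm a b
      by_cases hab : G.Adj a b <;> by_cases hvb : G.Adj u a <;>
        simp [*] at * <;> simp [*] <;> ring
    simp [*]
  have hrow : ∀ (c : ℝ) (w : V), ∑ a, ∑ b, (if a = w then (if P b then c * x b else 0) else 0) =
      c * ∑ b, if P b then x b else 0 := by
    intro c w
    rw [Finset.sum_comm]
    simp only [Finset.sum_ite_eq', Finset.mem_univ, if_true, Finset.mul_sum, mul_ite, mul_zero]
  have hcol : ∀ (c : ℝ) (w : V), ∑ a, ∑ b, (if b = w then (if P a then c * x a else 0) else 0) =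
      c * ∑ b, if P b then x b else 0 := by
    intro c w
    simp only [Finset.sum_ite_eq', Finset.mem_univ, if_true, Finset.mul_sum, mul_ite, mul_zero]
  rw [adjForm_eq_sum, adjForm_eq_sum]
  simp only [hpt, Finset.sum_add_distrib, Finset.sum_sub_distrib, hrow, hcol]
  ring

/-- In a graph of maximum spectral radius, the closed neighbourhoods of adjacent vertices are
nested, in the order given by an eigenvector. -/
theorem adj_of_adj_of_le (hx : ∀ i, 0 ≤ x i)
    (hmax : ∀ H : SimpleGraph V, ¬ HasListPath H k → ∀ z : V → ℝ, adjForm H z ≤ M * ∑ i, z i ^ 2)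
    (hG : ¬ HasListPath G k) (hxG : adjForm G x = M * ∑ i, x i ^ 2)
    (huv : G.Adj u v) (hle : x u ≤ x v) (hu : 0 < x u) {w : V} (hw : G.Adj u w) (hwv : w ≠ v) :
    G.Adj v w := by
  classical
  by_contra hvw
  have hK : ¬ HasListPath (kelmans G u v) k := fun h => hG (h.of_kelmans huv)
  have hform := adjForm_kelmans (G := G) (x := x) huv
  have hP : 0 ≤ ∑ w, if w ≠ v ∧ G.Adj u w ∧ ¬ G.Adj v w then x w else 0 :=
    Finset.sum_nonneg fun i _ => by split_ifs; exacts [hx i, le_rfl]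
  -- Hence `x` is a maximiser for the compressed graph too, and the eigenvalue equation at `v` holds
  -- in both graphs with the same `M`, although `v` has gained the neighbour `w` of positive weight.
  have hge : M * ∑ i, x i ^ 2 ≤ adjForm (kelmans G u v) x := by
    rw [hform, hxG]
    nlinarith [mul_nonneg (sub_nonneg.2 hle) hP]
  have e1 := nbrSum_eq_of_adjForm_max (hmax _ hK) hge v
  have e2 := nbrSum_eq_of_adjForm_max (hmax _ hG) hxG.ge v
  have e3 := nbrSum_eq_of_adjForm_max (hmax _ hG) hxG.ge w
  have hwpos : 0 < x w := by
    refine (hx w).lt_of_ne fun h0 => ?_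
    have := le_nbrSum (G := G) hx hw.symm
    rw [e3, ← h0, mul_zero] at this
    linarith
  have hlt : nbrSum G x v < nbrSum (kelmans G u v) x v := by
    unfold nbrSum
    refine Finset.sum_lt_sum (fun j _ => ?_) ⟨w, Finset.mem_univ _, ?_⟩
    · by_cases hj : G.Adj v j
      · have : (kelmans G u v).Adj v j :=
          Or.inl ⟨hj, fun h => huv.ne h.1.symm, fun h => h.2.1 rfl⟩
        simp [hj, this]
      · simp only [hj, if_false]
        split_ifs
        exacts [hx j, le_rfl]
    · have : (kelmans G u v).Adj v w := Or.inr (Or.inl ⟨rfl, hwv, hw, hvw⟩)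
      simpa [hvw, this] using hwpos
  rw [e1, e2] at hlt
  exact lt_irrefl _ hlt

/-- The form is at most that of the complete graph, `(∑ x) ^ 2 - ∑ x ^ 2`; Cauchy–Schwarz on the
support does the rest. -/
theorem adjForm_le_card_support (C : Finset V) (hC : ∀ i ∉ C, x i = 0) (hx : ∀ i, 0 ≤ x i) :
    adjForm G x ≤ ((C.card : ℝ) - 1) * ∑ i, x i ^ 2 := by
  classical
  have h1 : adjForm G x ≤ (∑ i, x i) ^ 2 - ∑ i, x i ^ 2 := by
    have h2 : (∑ i, x i) ^ 2 - ∑ i, x i ^ 2 = ∑ i, (x i * (∑ j, x j) - x i ^ 2) := by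
      rw [Finset.sum_sub_distrib, ← Finset.sum_mul, sq]
    rw [h2]
    refine Finset.sum_le_sum fun i _ => ?_
    have h3 : nbrSum G x i + x i ≤ ∑ j, x j := by
      rw [← Finset.sum_erase_add _ _ (Finset.mem_univ i), nbrSum,
        ← Finset.sum_erase_add _ _ (Finset.mem_univ i)]
      simp only [SimpleGraph.irrefl, if_false, add_zero]
      gcongr with j
      split_ifs
      exacts [le_rfl, hx j]
    nlinarith [hx i]
  have h4 : ∑ i ∈ C, x i = ∑ i, x i :=
    Finset.sum_subset (Finset.subset_univ _) fun i _ hi => hC i hi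
  have h5 : ∑ i ∈ C, x i ^ 2 = ∑ i, x i ^ 2 :=
    Finset.sum_subset (Finset.subset_univ _) fun i _ hi => by rw [hC i hi]; ring
  have h6 := sq_sum_le_card_mul_sum_sq (s := C) (f := x)
  rw [h4, h5] at h6
  linarith

/-- A graph of maximum spectral radius without a path on `k` vertices has a dominating vertex,
and its nonnegative leading eigenvector is positive. -/
theorem exists_dominating (hM : (k : ℝ) - 2 < M) (hx : ∀ i, 0 ≤ x i) (hx0 : x ≠ 0)
    (hmax : ∀ H : SimpleGraph V, ¬ HasListPath H k → ∀ z : V → ℝ, adjForm H z ≤ M * ∑ i, z i ^ 2)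
    (hG : ¬ HasListPath G k) (hxG : adjForm G x = M * ∑ i, x i ^ 2) :
    (∀ i, 0 < x i) ∧ ∃ v, (∀ i, x i ≤ x v) ∧ ∀ w, w ≠ v → G.Adj v w := by
  classical
  have heig := nbrSum_eq_of_adjForm_max (hmax _ hG) hxG.ge
  obtain ⟨i₀, hi₀⟩ := Function.ne_iff.1 hx0
  obtain ⟨v, -, hv⟩ := Finset.exists_max_image Finset.univ x ⟨i₀, Finset.mem_univ _⟩
  replace hv : ∀ i, x i ≤ x v := fun i => hv i (Finset.mem_univ _)
  have hvpos : 0 < x v := ((hx i₀).lt_of_ne' hi₀).trans_le (hv i₀)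
  have hnbrpos : ∀ u, G.Adj v u → 0 < x u := by
    intro u hu
    refine (hx u).lt_of_ne fun h0 => ?_
    have := le_nbrSum (G := G) hx hu.symm
    rw [heig, ← h0, mul_zero] at this
    linarith
  let C : Finset V := {u | u = v ∨ G.Adj v u}
  have hmemC : ∀ u, u ∈ C ↔ u = v ∨ G.Adj v u := fun u => by simp [C]
  have hclosed : ∀ u w, u ∈ C → G.Adj u w → w ∈ C := by
    intro u w hu huw
    rw [hmemC] at hu ⊢
    rcases hu with rfl | hu
    · exact Or.inr huw
    · by_cases hwv : w = v
      · exact Or.inl hwv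
      · exact Or.inr (adj_of_adj_of_le hx hmax hG hxG hu.symm (hv u) (hnbrpos u hu) huw hwv)
  -- The closed neighbourhood `C` of `v` has no edge leaving it, so the restriction of `x` to `C` is
  -- still an eigenvector for `M`.
  let x' : V → ℝ := fun i => if i ∈ C then x i else 0
  have hx'0 : ∀ i, 0 ≤ x' i := fun i => by
    simp only [x']; split_ifs; exacts [hx i, le_rfl]
  have hvC : v ∈ C := (hmemC v).2 (Or.inl rfl)
  have hx'v : x' v = x v := if_pos hvC
  have heig' : ∀ i, nbrSum G x' i = M * x' i := by
    intro i
    by_cases hi : i ∈ C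
    · simp only [x', hi, if_true, ← heig i, nbrSum]
      refine Finset.sum_congr rfl fun j _ => ?_
      split_ifs with h1 h2 <;> first | rfl | exact absurd (hclosed i j hi h1) h2
    · simp only [x', hi, if_false, nbrSum, mul_zero]
      refine Finset.sum_eq_zero fun j _ => ?_
      split_ifs with h1 h2 <;> first | rfl | exact absurd (hclosed j i h2 h1.symm) hi
  have hform := adjForm_eq_of_nbrSum heig'
  have hpos : 0 < ∑ i, x' i ^ 2 :=
    Finset.sum_pos' (fun j _ => sq_nonneg _) ⟨v, Finset.mem_univ _, by rw [hx'v]; positivity⟩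
  have hcard : k ≤ C.card := by
    by_contra! hlt
    have h1 := adjForm_le_card_support (G := G) C (x := x') (fun i hi => if_neg hi) hx'0
    rw [hform] at h1
    have h2 := le_of_mul_le_mul_right h1 hpos
    have h3 : (C.card : ℝ) + 1 ≤ k := by exact_mod_cast hlt
    linarith
  -- A vertex `w` outside `C` could be hung on `v` without creating a path on `k` vertices or
  -- lowering the form at `x'`. But `x'` vanishes at `w` and is positive at `v`, which contradicts
  -- the eigenvalue equation at `w`.
  have hall : ∀ w, w ∈ C := by
    intro w
    by_contra hw
    have hvw : v ≠ w := fun h => hw (h ▸ hvC)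
    have hP : ¬ HasListPath (pendantGraph G C v w hvw) k := fun h =>
      hG (h.of_pendantGraph hvw hw (fun a ha hav => ((hmemC a).1 ha).resolve_left hav) hvC hcard)
    have hle : adjForm G x' ≤ adjForm (pendantGraph G C v w hvw) x' := by
      refine adjForm_mono hx'0 fun a b hab ha hb => Or.inl ⟨hab, ?_, ?_⟩
      · by_contra h; exact ha (if_neg h)
      · by_contra h; exact hb (if_neg h)
    rw [hform] at hle
    have e1 := nbrSum_eq_of_adjForm_max (hmax _ hP) hle w
    have e2 := le_nbrSum (G := pendantGraph G C v w hvw) hx'0 (i := w) (j := v)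
      (Or.inr (Or.inr ⟨rfl, rfl⟩))
    have e3 : x' w = 0 := if_neg hw
    rw [e1, e3, mul_zero, hx'v] at e2
    linarith
  refine ⟨fun i => ?_, v, hv, fun w hw => ((hmemC w).1 (hall w)).resolve_left hw⟩
  rcases (hmemC i).1 (hall i) with rfl | h
  exacts [hvpos, hnbrpos i h]

end Extremal

/-! ### Bounds on the form from positive supersolutions. -/

section Weights

variable {V : Type*} [Fintype V] {G : SimpleGraph V} {x y : V → ℝ} {M : ℝ}

/-- Edge by edge this is `2ab ≤ a²q + b²/q` with `q = y j / y i`. -/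
theorem adjForm_le_sum_div (hy : ∀ i, 0 < y i) :
    adjForm G x ≤ ∑ i, x i ^ 2 / y i * nbrSum G y i := by
  classical
  have h1 : ∑ i, x i ^ 2 / y i * nbrSum G y i =
      ∑ i, ∑ j, if G.Adj i j then x i ^ 2 / y i * y j else 0 := by
    simp only [nbrSum, Finset.mul_sum, mul_ite, mul_zero]
  have h2 : ∑ i, x i ^ 2 / y i * nbrSum G y i =
      ∑ i, ∑ j, if G.Adj i j then x j ^ 2 / y j * y i else 0 := by
    rw [h1, Finset.sum_comm]
    simp only [G.adj_comm]
  suffices h : 2 * adjForm G x ≤ 2 * ∑ i, x i ^ 2 / y i * nbrSum G y i by linarith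
  rw [two_mul (∑ i, x i ^ 2 / y i * nbrSum G y i)]
  nth_rewrite 1 [h1]
  rw [h2, adjForm_eq_sum, Finset.mul_sum, ← Finset.sum_add_distrib]
  refine Finset.sum_le_sum fun i _ => ?_
  rw [Finset.mul_sum, ← Finset.sum_add_distrib]
  refine Finset.sum_le_sum fun j _ => ?_
  split_ifs
  · have hi := hy i
    have hj := hy j
    have h3 : x i ^ 2 / y i * y j + x j ^ 2 / y j * y i - 2 * (x i * x j) =
        (x i * y j - x j * y i) ^ 2 / (y i * y j) := by
      field_simp
      ring
    have h4 : 0 ≤ (x i * y j - x j * y i) ^ 2 / (y i * y j) := by positivity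
    linarith
  · simp

/-- A positive supersolution bounds the quadratic form of the adjacency matrix. -/
theorem adjForm_le_of_supersolution (hy : ∀ i, 0 < y i) (h : ∀ i, nbrSum G y i ≤ M * y i) :
    adjForm G x ≤ M * ∑ i, x i ^ 2 := by
  refine (adjForm_le_sum_div hy).trans ?_
  rw [Finset.mul_sum]
  refine Finset.sum_le_sum fun i _ => ?_
  have hi := hy i
  calc x i ^ 2 / y i * nbrSum G y i ≤ x i ^ 2 / y i * (M * y i) :=
        mul_le_mul_of_nonneg_left (h i) (by positivity)
    _ = M * x i ^ 2 := by field_simp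

theorem adjForm_lt_of_supersolution (hy : ∀ i, 0 < y i) (h : ∀ i, nbrSum G y i ≤ M * y i) {i₀ : V}
    (h₀ : nbrSum G y i₀ < M * y i₀) (hx : x i₀ ≠ 0) :
    adjForm G x < M * ∑ i, x i ^ 2 := by
  refine (adjForm_le_sum_div hy).trans_lt ?_
  rw [Finset.mul_sum]
  have heq : ∀ i, M * x i ^ 2 = x i ^ 2 / y i * (M * y i) := fun i => by
    have hi := hy i
    field_simp
  refine Finset.sum_lt_sum (fun i _ => ?_) ⟨i₀, Finset.mem_univ _, ?_⟩
  · have hi := hy i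
    rw [heq]
    exact mul_le_mul_of_nonneg_left (h i) (by positivity)
  · have hi := hy i₀
    rw [heq]
    exact mul_lt_mul_of_pos_left h₀ (by positivity)

end Weights

/-! ### Test weights for `graphW` and the level `μ`. -/

section GraphW

variable {n m s : ℕ}

theorem nbrSum_graphW_of_lt (x : Fin n → ℝ) (hms : 2 * s ≤ m) {i : Fin n} (hi : i.val < s) :
    nbrSum (graphW n m s) x i = (∑ j, x j) - x i := by
  rw [nbrSum, ← Finset.sum_erase_add _ x (Finset.mem_univ i),
    ← Finset.sum_erase_add _ _ (Finset.mem_univ i)]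
  simp only [SimpleGraph.irrefl, if_false, add_zero, add_sub_cancel_right]
  refine Finset.sum_congr rfl fun j hj => if_pos ?_
  have hne : i ≠ j := (Finset.ne_of_mem_erase hj).symm
  refine ⟨hne, ?_⟩
  omega

theorem nbrSum_graphW_of_mem_middle (x : Fin n → ℝ) {i : Fin n} (hi : s ≤ i.val)
    (hi' : i.val < m - s) :
    nbrSum (graphW n m s) x i = (∑ j, if j.val < m - s then x j else 0) - x i := by
  rw [nbrSum, ← Finset.sum_erase_add _ (fun j : Fin n => if j.val < m - s then x j else 0)
    (Finset.mem_univ i), ← Finset.sum_erase_add _ _ (Finset.mem_univ i)]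
  simp only [SimpleGraph.irrefl, if_false, add_zero, hi', if_true, add_sub_cancel_right]
  refine Finset.sum_congr rfl fun j hj => ?_
  have hne : i ≠ j := (Finset.ne_of_mem_erase hj).symm
  have : (graphW n m s).Adj i j ↔ j.val < m - s := by
    simp only [graphW, hne, ne_eq, not_false_eq_true, true_and]
    omega
  simp only [this]

theorem nbrSum_graphW_of_ge (x : Fin n → ℝ) (hms : 2 * s ≤ m) {i : Fin n} (hi : m - s ≤ i.val) :
    nbrSum (graphW n m s) x i = ∑ j, if j.val < s then x j else 0 := by
  rw [nbrSum]
  refine Finset.sum_congr rfl fun j hj => ?_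
  have : (graphW n m s).Adj i j ↔ j.val < s := by
    simp only [graphW]
    constructor
    · intro h; omega
    · intro h
      refine ⟨?_, by omega⟩
      rintro rfl
      omega
  simp only [this]

theorem sum_fin_ite_lt (f : ℕ → ℝ) {a : ℕ} (ha : a ≤ n) :
    ∑ j : Fin n, (if j.val < a then f j else 0) = ∑ j ∈ Finset.range a, f j := by
  rw [Fin.sum_univ_eq_sum_range (fun j => if j < a then f j else 0), ← Finset.sum_filter]
  refine Finset.sum_congr ?_ fun _ _ => rfl
  ext j
  simp only [Finset.mem_filter, Finset.mem_range]
  omega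

/-- The weights of a supersolution for `graphW n m s` at level `μ`. -/
noncomputable def weightW (m s : ℕ) (μ : ℝ) (i : ℕ) : ℝ :=
  if i < s then 1 else if i < m - s then s / (μ - m + 1 + 2 * s) else s / μ

/-- The value of the adjacency operator of `graphW n m s` on its weights, at the vertices of `X`. -/
noncomputable def levelW (n m s : ℕ) (μ : ℝ) : ℝ :=
  -1 + s * (μ + 1) / (μ - m + 1 + 2 * s) + ((n : ℝ) - m + s) * s / μ

theorem sum_range_weightW_left (μ : ℝ) : ∑ j ∈ Finset.range s, weightW m s μ j = s := by
  rw [Finset.sum_congr rfl (g := fun _ => (1 : ℝ))]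
  · simp
  · intro j hj
    simp [weightW, Finset.mem_range.1 hj]

theorem sum_range_weightW_middle (hms : 2 * s ≤ m) (μ : ℝ) :
    ∑ j ∈ Finset.range (m - s), weightW m s μ j =
      s + ((m : ℝ) - 2 * s) * (s / (μ - m + 1 + 2 * s)) := by
  obtain ⟨q, rfl⟩ := Nat.exists_eq_add_of_le hms
  have h1 : 2 * s + q - s = s + q := by omega
  rw [h1, Finset.sum_range_add, sum_range_weightW_left,
    Finset.sum_congr rfl (g := fun _ => (s : ℝ) / (μ - (2 * s + q : ℕ) + 1 + 2 * s))]
  · simp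
  · intro j hj
    have := Finset.mem_range.1 hj
    simp [weightW, h1, this]

theorem sum_range_weightW (hms : 2 * s ≤ m) (hn : m ≤ n) (μ : ℝ) :
    ∑ j ∈ Finset.range n, weightW m s μ j =
      s + ((m : ℝ) - 2 * s) * (s / (μ - m + 1 + 2 * s)) + ((n : ℝ) - m + s) * (s / μ) := by
  obtain ⟨z, hz⟩ := Nat.exists_eq_add_of_le (show m - s ≤ n by omega)
  have hzr : (z : ℝ) = n - m + s := by
    have : n + s = m + z := by omega
    have : (n : ℝ) + s = m + z := by exact_mod_cast this
    linarith
  rw [← hzr, hz, Finset.sum_range_add, sum_range_weightW_middle hms,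
    Finset.sum_congr rfl (s₁ := Finset.range z) (g := fun _ => (s : ℝ) / μ)]
  · simp
  · intro j hj
    have h1 : ¬ (m - s + j < s) := by omega
    simp [weightW, h1]

theorem weightW_pos {μ : ℝ} (hs : 1 ≤ s) (hm : 1 ≤ m) (hμ : (m : ℝ) - 1 < μ) (i : ℕ) :
    0 < weightW m s μ i := by
  have h1 : (1 : ℝ) ≤ s := by exact_mod_cast hs
  have h2 : (1 : ℝ) ≤ m := by exact_mod_cast hm
  unfold weightW
  split_ifs
  · exact one_pos
  · exact div_pos (by linarith) (by linarith)
  · exact div_pos (by linarith) (by linarith)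

/-- The weights are chosen to solve the eigenvalue equation at `μ` exactly on `Y` and `Z`, leaving
one condition on `X`: they form an eigenvector when `levelW n m s μ = μ` and a supersolution when
`levelW n m s μ ≤ μ`. -/
theorem nbrSum_weightW {μ : ℝ} (hm : 1 ≤ m) (hms : 2 * s ≤ m) (hn : m ≤ n)
    (hμ : (m : ℝ) - 1 < μ) (i : Fin n) :
    nbrSum (graphW n m s) (fun j => weightW m s μ j) i =
      if i.val < s then levelW n m s μ else μ * weightW m s μ i := by
  have h2 : (1 : ℝ) ≤ m := by exact_mod_cast hm
  have h3 : (0 : ℝ) ≤ s := by positivity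
  have hμ0 : μ ≠ 0 := by linarith
  have hd : μ - m + 1 + 2 * s ≠ 0 := by linarith
  obtain ⟨D, hD⟩ : ∃ D, D = μ - m + 1 + 2 * s := ⟨_, rfl⟩
  by_cases h : i.val < s
  · rw [if_pos h, nbrSum_graphW_of_lt _ hms h, Fin.sum_univ_eq_sum_range (weightW m s μ),
      sum_range_weightW hms hn]
    simp only [weightW, h, if_true, levelW]
    rw [← hD] at hd ⊢
    rw [show (m : ℝ) = μ + 1 + 2 * s - D by linarith]
    field_simp
    ring
  rw [if_neg h]
  by_cases h' : i.val < m - s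
  · rw [nbrSum_graphW_of_mem_middle _ (by omega) h', sum_fin_ite_lt _ (by omega),
      sum_range_weightW_middle hms]
    simp only [weightW, h, h', if_true, if_false]
    rw [← hD] at hd ⊢
    rw [show (m : ℝ) = μ + 1 + 2 * s - D by linarith]
    field_simp
    ring
  · rw [nbrSum_graphW_of_ge _ hms (by omega), sum_fin_ite_lt _ (by omega),
      sum_range_weightW_left]
    simp only [weightW, h, h', if_false]
    field_simp

/-- At the `μ` solving the equation for `t`, this makes the weights for a smaller `s` a strict
supersolution. -/
theorem levelW_lt {t : ℕ} {μ : ℝ} (hst : s < t) (hm : 1 ≤ m) (hn : m ≤ n)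
    (hμ : (m : ℝ) - 1 < μ) : levelW n m s μ < levelW n m t μ := by
  have h1 : (s : ℝ) < t := by exact_mod_cast hst
  have h2 : (1 : ℝ) ≤ m := by exact_mod_cast hm
  have h3 : (m : ℝ) ≤ n := by exact_mod_cast hn
  have h4 : (0 : ℝ) ≤ s := by positivity
  have hμ0 : 0 < μ := by linarith
  unfold levelW
  have e1 : (s : ℝ) * (μ + 1) / (μ - m + 1 + 2 * s) < t * (μ + 1) / (μ - m + 1 + 2 * t) := by
    rw [div_lt_div_iff₀ (by linarith) (by linarith)]
    have : 0 < (μ + 1) * ((t - s) * (μ - m + 1)) :=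
      mul_pos (by linarith) (mul_pos (by linarith) (by linarith))
    nlinarith
  have e2 : ((n : ℝ) - m + s) * s / μ ≤ ((n : ℝ) - m + t) * t / μ := by
    refine div_le_div_of_nonneg_right ?_ hμ0.le
    exact mul_le_mul (by linarith) h1.le h4 (by linarith)
  linarith

/-- Intermediate value theorem on `[m - 1, n]`. The left end is the eigenvalue of a clique on `m`
vertices; being strictly above it is what `exists_dominating` needs. -/
theorem exists_levelW_eq {t : ℕ} (ht : 1 ≤ t) (hmt : 2 * t + 1 ≤ m) (hmt' : m ≤ 2 * t + 2)
    (hn : 3 * (m + 1) ≤ n) : ∃ μ : ℝ, (m : ℝ) - 1 < μ ∧ levelW n m t μ = μ := by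
  have h1 : (1 : ℝ) ≤ t := by exact_mod_cast ht
  have h2 : 2 * (t : ℝ) + 1 ≤ m := by exact_mod_cast hmt
  have h3 : (m : ℝ) ≤ 2 * t + 2 := by exact_mod_cast hmt'
  have h4 : 3 * ((m : ℝ) + 1) ≤ n := by exact_mod_cast hn
  have hcont : ContinuousOn (fun μ => levelW n m t μ - μ) (Set.Icc ((m : ℝ) - 1) n) := by
    unfold levelW
    refine ContinuousOn.sub (ContinuousOn.add (ContinuousOn.add continuousOn_const ?_) ?_)
      continuousOn_id
    · refine ContinuousOn.div (by fun_prop) (by fun_prop) fun μ hμ => ?_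
      have := hμ.1
      linarith
    · refine ContinuousOn.div (by fun_prop) (by fun_prop) fun μ hμ => ?_
      have := hμ.1
      linarith
  -- The size of `n` matters here: at `μ = m - 1` the second term is `m / 2`, so the contribution of
  -- `Z` has to exceed `m / 2`.
  have hleft : 0 < levelW n m t (m - 1) - (m - 1) := by
    unfold levelW
    have e1 : (t : ℝ) * ((m : ℝ) - 1 + 1) / ((m : ℝ) - 1 - m + 1 + 2 * t) = m / 2 := by
      have : (t : ℝ) ≠ 0 := by linarith
      field_simp
      ring
    have e2 : (m : ℝ) / 2 < ((n : ℝ) - m + t) * t / (m - 1) := by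
      rw [lt_div_iff₀ (by linarith)]
      nlinarith
    rw [e1]
    linarith
  have hright : levelW n m t n - n ≤ 0 := by
    unfold levelW
    have hn0 : (0 : ℝ) < n := by linarith
    have e1 : (t : ℝ) * ((n : ℝ) + 1) / ((n : ℝ) - m + 1 + 2 * t) ≤ 2 * t := by
      rw [div_le_iff₀ (by linarith)]
      nlinarith
    have e2 : ((n : ℝ) - m + t) * t / n ≤ t := by
      rw [div_le_iff₀ hn0]
      nlinarith
    linarith
  obtain ⟨μ, hμ, h⟩ := intermediate_value_Icc' (by linarith) hcont ⟨hright, hleft.le⟩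
  simp only at h
  refine ⟨μ, hμ.1.lt_of_ne ?_, by linarith⟩
  rintro rfl
  linarith

end GraphW

theorem isChain_of_pairwise_adj {V : Type*} {G : SimpleGraph V} {l : List V} (hn : l.Nodup)
    (h : ∀ a ∈ l, ∀ b ∈ l, a ≠ b → G.Adj a b) : l.IsChain G.Adj :=
  List.Pairwise.isChain (hn.imp_of_mem fun ha hb hab => h _ ha _ hb hab)

/-! ### Long paths in nested graphs. -/

section NestedGraph

variable {V : Type*} [Fintype V] [LinearOrder V] {G : SimpleGraph V}

open Classical in
/-- The neighbours of `j` that precede `j`. -/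
noncomputable def upNbrs (G : SimpleGraph V) (j : V) : Finset V := {i | i < j ∧ G.Adj i j}

open Classical in
/-- The vertices that lie below or at a vertex with at least `d` preceding neighbours. -/
noncomputable def upCore (G : SimpleGraph V) (d : ℕ) : Finset V :=
  {l | ∃ j, l ∈ insert j (upNbrs G j) ∧ d ≤ (upNbrs G j).card}

/-- The order of the vertices is nested: a vertex dominates its later neighbours. -/
def IsNestedOrder (G : SimpleGraph V) : Prop :=
  ∀ i j l, i < j → G.Adj i j → G.Adj j l → l ≠ i → G.Adj i l

theorem mem_upNbrs {i j : V} : i ∈ upNbrs G j ↔ i < j ∧ G.Adj i j := by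
  simp [upNbrs]

/-- Transitivity, together with `IsNestedOrder.adj_of_mem`, makes `upNbrs` the ancestor relation of
a rooted forest, in which `insert j (upNbrs G j)` is the chain from a root to `j`. -/
theorem IsNestedOrder.upNbrs_trans (hN : IsNestedOrder G) {i j l : V} (hij : i ∈ upNbrs G j)
    (hjl : j ∈ upNbrs G l) : i ∈ upNbrs G l := by
  rw [mem_upNbrs] at *
  have h := hij.1.trans hjl.1
  exact ⟨h, hN i j l hij.1 hij.2 hjl.2 h.ne'⟩

theorem IsNestedOrder.adj_of_mem (hN : IsNestedOrder G) {j a b : V}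
    (ha : a ∈ insert j (upNbrs G j)) (hb : b ∈ insert j (upNbrs G j)) (hab : a ≠ b) :
    G.Adj a b := by
  have key : ∀ a b, a < b → a ∈ upNbrs G j → b ∈ upNbrs G j → G.Adj a b := by
    intro a b hab ha hb
    rw [mem_upNbrs] at ha hb
    exact hN a j b ha.1 ha.2 hb.2.symm hab.ne'
  rw [Finset.mem_insert] at ha hb
  rcases ha with rfl | ha <;> rcases hb with rfl | hb
  · exact absurd rfl hab
  · exact (mem_upNbrs.1 hb).2.symm
  · exact (mem_upNbrs.1 ha).2
  · rcases hab.lt_or_gt with h | h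
    exacts [key a b h ha hb, (key b a h hb ha).symm]

theorem IsNestedOrder.mem_of_mem_upNbrs (hN : IsNestedOrder G) {j a b : V}
    (ha : a ∈ insert j (upNbrs G j)) (hb : b ∈ upNbrs G a) : b ∈ insert j (upNbrs G j) := by
  rw [Finset.mem_insert] at ha ⊢
  rcases ha with rfl | ha
  exacts [Or.inr hb, Or.inr (hN.upNbrs_trans hb ha)]

/-- A path through part of a chain `K` of dominating vertices, waiting to be continued through the
remaining vertices `T` of `K`, can be completed to a path on `k` vertices if the cores are large. -/
theorem IsNestedOrder.hasListPath_of_partial (hN : IsNestedOrder G) {v₀ j₀ : V} {k n₀ : ℕ}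
    (hv₀ : ∀ j, v₀ ∈ insert j (upNbrs G j))
    (hcore : ∀ n, 1 ≤ n → n ≤ n₀ → k - n + 1 ≤ (upCore G n).card) (n : ℕ) :
    n ≤ n₀ → ∀ (L : List V) (T : Finset V), L.IsChain G.Adj → L.Nodup →
      (∀ a ∈ L.getLast?, ∀ b ∈ T, G.Adj a b) →
      (∀ a ∈ insert j₀ (upNbrs G j₀), a ∈ T ∨ a ∈ L) → (∀ a ∈ L, a ∉ T) →
      T ⊆ insert j₀ (upNbrs G j₀) →
      (∀ a ∈ L, a ∉ insert j₀ (upNbrs G j₀) → ∀ b ∈ T, G.Adj b a) →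
      (∀ a ∈ T, ∀ b ∈ insert j₀ (upNbrs G j₀), b < a → b ∈ T) →
      n ≤ T.card → L.length + T.card + n = k → HasListPath G k := by
  set K := insert j₀ (upNbrs G j₀) with hK
  induction n using Nat.strong_induction_on with
  | _ n ih =>
  intro hn L T hL hLn hlast hcover hdisj hTK hLT hinit hnT hlen
  have hKadj : ∀ a ∈ K, ∀ b ∈ K, a ≠ b → G.Adj a b := fun a ha b hb => hN.adj_of_mem ha hb
  have hKup : ∀ a ∈ K, ∀ b ∈ upNbrs G a, b ∈ K := fun a ha b => hN.mem_of_mem_upNbrs ha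
  -- Here `n` counts the vertices still to be found outside `K`; when none is missing, the clique
  -- `T` completes the path.
  rcases Nat.eq_zero_or_pos n with rfl | hn1
  · refine ⟨L ++ T.toList, hL.append ?_ ?_, ?_, by simpa using hlen⟩
    · refine isChain_of_pairwise_adj T.nodup_toList fun a ha b hb hab => ?_
      rw [Finset.mem_toList] at ha hb
      exact hKadj a (hTK ha) b (hTK hb) hab
    · intro a ha b hb
      exact hlast a ha b (Finset.mem_toList.1 (List.mem_of_mem_head? hb))
    · refine hLn.append T.nodup_toList fun a ha hb => ?_
      exact hdisj a ha (Finset.mem_toList.1 hb)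
  -- `L` and `T` together have `k - n` vertices, fewer than the core.
  obtain ⟨u, huC, huLT⟩ : ∃ u ∈ upCore G n, u ∉ L.toFinset ∪ T := by
    refine Finset.exists_mem_notMem_of_card_lt_card ?_
    have h1 := hcore n hn1 hn
    have h2 := Finset.card_union_le L.toFinset T
    rw [List.toFinset_card_of_nodup hLn] at h2
    omega
  rw [Finset.mem_union, List.mem_toFinset, not_or] at huLT
  obtain ⟨huL, huT⟩ := huLT
  have huK : u ∉ K := fun h => (hcover u h).elim huT huL
  have hTne : T.Nonempty := Finset.card_pos.1 (by omega)
  -- If `u` is below all of `T`, the last vertex of `T` is spent to reach `u`, so `n` and `|T|` both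
  -- drop by one.
  by_cases hA : ∀ b ∈ T, G.Adj b u
  · obtain ⟨v, hvT, hvmax⟩ := T.exists_max_image id hTne
    have huv : v ≠ u := fun h => huT (h ▸ hvT)
    have hcard := Finset.card_erase_of_mem hvT
    refine ih (n - 1) (by omega) (by omega) (L ++ [v, u]) (T.erase v) ?_ ?_ ?_ ?_ ?_ ?_ ?_ ?_ ?_ ?_
    · refine hL.append (List.isChain_pair.2 (hA v hvT)) fun a ha b hb => ?_
      obtain rfl : v = b := by simpa using hb
      exact hlast a ha v hvT
    · refine hLn.append (by simpa using huv) fun a ha hb => ?_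
      simp only [List.mem_cons, List.not_mem_nil, or_false] at hb
      rcases hb with rfl | rfl
      exacts [hdisj _ ha hvT, huL ha]
    · intro a ha b hb
      obtain rfl : u = a := by simpa using ha
      exact (hA b (Finset.mem_of_mem_erase hb)).symm
    · intro a ha
      by_cases hav : a = v
      · exact Or.inr (by simp [hav])
      · exact (hcover a ha).imp (fun h => Finset.mem_erase.2 ⟨hav, h⟩)
          fun h => List.mem_append_left _ h
    · intro a ha haT
      have haT' := Finset.mem_erase.1 haT
      rw [List.mem_append] at ha
      rcases ha with ha | ha
      · exact hdisj a ha haT'.2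
      · simp only [List.mem_cons, List.not_mem_nil, or_false] at ha
        rcases ha with rfl | rfl
        exacts [haT'.1 rfl, huT haT'.2]
    · exact (Finset.erase_subset _ _).trans hTK
    · intro a ha haK b hb
      have hbT := Finset.mem_of_mem_erase hb
      rw [List.mem_append] at ha
      rcases ha with ha | ha
      · exact hLT a ha haK b hbT
      · simp only [List.mem_cons, List.not_mem_nil, or_false] at ha
        rcases ha with rfl | rfl
        exacts [absurd (hTK hvT) haK, hA b hbT]
    · intro a ha b hb hba
      have haT := Finset.mem_of_mem_erase ha
      refine Finset.mem_erase.2 ⟨?_, hinit a haT b hb hba⟩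
      rintro rfl
      exact (hba.trans_le (hvmax a haT)).false
    · omega
    · simp only [List.length_append, List.length_cons, List.length_nil]
      omega
  push Not at hA
  obtain ⟨v, hvT, hvu⟩ := hA
  obtain ⟨j, huB, hnj⟩ : ∃ j, u ∈ insert j (upNbrs G j) ∧ n ≤ (upNbrs G j).card := by
    simpa only [upCore, Finset.mem_filter, Finset.mem_univ, true_and] using huC
  set B := insert j (upNbrs G j) with hB
  have hBcard : n + 1 ≤ B.card := by
    rw [hB, Finset.card_insert_of_notMem (fun h => (mem_upNbrs.1 h).1.false)]
    omega
  have hBadj : ∀ a ∈ B, ∀ b ∈ B, a ≠ b → G.Adj a b := fun a ha b hb => hN.adj_of_mem ha hb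
  have hBup : ∀ a ∈ B, ∀ b ∈ upNbrs G a, b ∈ B := fun a ha b => hN.mem_of_mem_upNbrs ha
  have hvB : v ∉ B := fun h => hvu (hBadj v h u huB fun e => huK (e ▸ hTK hvT))
  -- The chain `B` leaves `K` before reaching `v`, so all of `B ∩ K` precedes `v` and lies in the
  -- initial segment `T`.
  have hKBT : ∀ b ∈ K, b ∈ B → b ∈ T := by
    intro b hbK hbB
    have hbu : b ≠ u := fun e => huK (e ▸ hbK)
    have hadj := hBadj b hbB u huB hbu
    have hlt : b < u := by
      refine lt_of_not_ge fun h => huK (hKup b hbK u ?_)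
      exact mem_upNbrs.2 ⟨lt_of_le_of_ne h hbu.symm, hadj.symm⟩
    by_contra hbT
    have hvb : v < b := by
      refine lt_of_not_ge fun h => ?_
      rcases h.lt_or_eq with h | h
      exacts [hbT (hinit v hvT b hbK h), hbT (h ▸ hvT)]
    have h1 : v ∈ upNbrs G b := mem_upNbrs.2 ⟨hvb, hKadj v (hTK hvT) b hbK hvb.ne⟩
    exact hvB (hBup b hbB v h1)
  -- Vertices of `L` outside `K` lie below all of `T`, in particular below `v ∉ B`.
  have hDL : ∀ d ∈ B, d ∉ K → d ∉ L := by
    intro d hdB hdK hdL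
    have hadj := hLT d hdL hdK v hvT
    have hvd : v < d := by
      refine lt_of_not_ge fun h => hdK (hKup v (hTK hvT) d ?_)
      exact mem_upNbrs.2 ⟨lt_of_le_of_ne h hadj.ne', hadj.symm⟩
    exact hvB (hBup d hdB v (mem_upNbrs.2 ⟨hvd, hadj⟩))
  set T₁ := T ∩ B with hT₁
  have hT₁ne : T₁.Nonempty :=
    ⟨v₀, Finset.mem_inter.2 ⟨hKBT v₀ (hv₀ j₀) (hv₀ j), hv₀ j⟩⟩
  have hDcard : n + 1 ≤ (B \ K).card + T₁.card := by
    have h1 : B ∩ K ⊆ T₁ := fun b hb => by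
      rw [Finset.mem_inter] at hb
      exact Finset.mem_inter.2 ⟨hKBT b hb.2 hb.1, hb.1⟩
    have h2 := Finset.card_le_card h1
    have h3 := Finset.card_sdiff_add_card_inter B K
    omega
  have huD : u ∈ B \ K := Finset.mem_sdiff.2 ⟨huB, huK⟩
  have hDpos : 1 ≤ (B \ K).card := Finset.card_pos.2 ⟨u, huD⟩
  have hT₁pos : 1 ≤ T₁.card := Finset.card_pos.2 hT₁ne
  -- Taking `n + 1 - |T₁|` vertices preserves the invariant `n - |D| ≤ |T₁| - 1`; at least one is
  -- taken so that the induction descends.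
  obtain ⟨D, hDsub, hDp⟩ := Finset.exists_subset_card_eq
    (show max 1 (n + 1 - T₁.card) ≤ (B \ K).card by omega)
  have hDne : D.toList ≠ [] := by
    rw [← List.length_pos_iff, Finset.length_toList]
    omega
  have hDB : ∀ d ∈ D, d ∈ B := fun d hd => (Finset.mem_sdiff.1 (hDsub hd)).1
  have hDK : ∀ d ∈ D, d ∉ K := fun d hd => (Finset.mem_sdiff.1 (hDsub hd)).2
  obtain ⟨w, hwT₁, hwmax⟩ := T₁.exists_max_image id hT₁ne
  have hwT : w ∈ T := (Finset.mem_inter.1 hwT₁).1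
  have hwB : w ∈ B := (Finset.mem_inter.1 hwT₁).2
  have hcard := Finset.card_erase_of_mem hwT₁
  have hcard' := Finset.card_sdiff_add_card_inter T B
  rw [← hT₁] at hcard'
  have hwT₀ : w ∉ T \ B := fun h => (Finset.mem_sdiff.1 h).2 hwB
  have hmid : ∀ a ∈ (T \ B).toList ++ [w], a ∈ T := by
    intro a ha
    simp only [List.mem_append, Finset.mem_toList, Finset.mem_sdiff, List.mem_singleton] at ha
    rcases ha with ha | rfl
    exacts [ha.1, hwT]
  have hmidn : ((T \ B).toList ++ [w]).Nodup := by
    refine (Finset.nodup_toList _).append (List.nodup_singleton w) fun a ha hb => ?_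
    rw [List.mem_singleton] at hb
    rw [Finset.mem_toList, hb] at ha
    exact hwT₀ ha
  have hmem : ∀ a, a ∈ L ++ (((T \ B).toList ++ [w]) ++ D.toList) ↔
      a ∈ L ∨ (a ∈ T ∧ a ∉ B) ∨ a = w ∨ a ∈ D := by
    intro a
    simp only [List.mem_append, Finset.mem_toList, Finset.mem_sdiff, List.mem_singleton, or_assoc]
  -- The path sweeps up `T \ B`, crosses at the last common vertex `w` into `D`, and stops next to
  -- all that is left of `T₁`.
  refine ih (n - D.card) (by omega) (by omega) (L ++ (((T \ B).toList ++ [w]) ++ D.toList))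
    (T₁.erase w) ?_ ?_ ?_ ?_ ?_ ?_ ?_ ?_ ?_ ?_
  · refine hL.append ?_ fun a ha b hb => ?_
    · rw [List.append_assoc, List.singleton_append, List.isChain_split]
      refine ⟨isChain_of_pairwise_adj hmidn fun a ha b hb hab =>
        hKadj a (hTK (hmid a ha)) b (hTK (hmid b hb)) hab, ?_⟩
      have hmemB : ∀ a ∈ w :: D.toList, a ∈ B := by
        intro a ha
        rw [List.mem_cons, Finset.mem_toList] at ha
        rcases ha with rfl | ha
        exacts [hwB, hDB a ha]
      refine isChain_of_pairwise_adj (List.nodup_cons.2 ⟨?_, D.nodup_toList⟩)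
        fun a ha b hb hab => hBadj a (hmemB a ha) b (hmemB b hb) hab
      rw [Finset.mem_toList]
      exact fun h => hDK w h (hTK hwT)
    · refine hlast a ha b (hmid b ?_)
      rw [List.head?_append_of_ne_nil _ (by simp)] at hb
      exact List.mem_of_mem_head? hb
  · refine hLn.append (hmidn.append D.nodup_toList fun a ha hb => ?_) fun a ha hb => ?_
    · exact hDK a (Finset.mem_toList.1 hb) (hTK (hmid a ha))
    · rw [List.mem_append, Finset.mem_toList] at hb
      rcases hb with hb | hb
      exacts [hdisj a ha (hmid a hb), hDL a (hDB a hb) (hDK a hb) ha]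
  · intro a ha b hb
    rw [← List.append_assoc, List.getLast?_append_of_ne_nil _ hDne] at ha
    have haD : a ∈ D := Finset.mem_toList.1 (List.mem_of_mem_getLast? ha)
    have hb' := Finset.mem_inter.1 (Finset.mem_of_mem_erase hb)
    exact hBadj a (hDB a haD) b hb'.2 fun e => hDK a haD (e ▸ hTK hb'.1)
  · intro a ha
    rw [hmem, Finset.mem_erase, hT₁, Finset.mem_inter]
    have := hcover a ha
    tauto
  · intro a ha haT
    rw [hmem] at ha
    obtain ⟨haw, haT⟩ := Finset.mem_erase.1 haT
    obtain ⟨haT, haB⟩ := Finset.mem_inter.1 haT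
    rcases ha with ha | ha | ha | ha
    exacts [hdisj a ha haT, ha.2 haB, haw ha, hDK a ha (hTK haT)]
  · exact (Finset.erase_subset _ _).trans (Finset.inter_subset_left.trans hTK)
  · intro a ha haK b hb
    obtain ⟨hbT, hbB⟩ := Finset.mem_inter.1 (Finset.mem_of_mem_erase hb)
    rw [hmem] at ha
    rcases ha with ha | ha | rfl | ha
    · exact hLT a ha haK b hbT
    · exact absurd (hTK ha.1) haK
    · exact absurd (hTK hwT) haK
    · exact hBadj b hbB a (hDB a ha) fun e => haK (e ▸ hTK hbT)
  · intro a ha b hb hba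
    obtain ⟨haw, haT₁⟩ := Finset.mem_erase.1 ha
    obtain ⟨haT, haB⟩ := Finset.mem_inter.1 haT₁
    have h1 : b ∈ upNbrs G a := mem_upNbrs.2 ⟨hba, hKadj b hb a (hTK haT) hba.ne⟩
    have hbB := hBup a haB b h1
    refine Finset.mem_erase.2 ⟨?_, Finset.mem_inter.2 ⟨hKBT b hb hbB, hbB⟩⟩
    rintro rfl
    exact (hba.trans_le (hwmax a haT₁)).false
  · omega
  · simp only [List.length_append, Finset.length_toList, List.length_singleton]
    omega

/-- A nested graph all of whose cores are large contains a path on `k` vertices. -/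
theorem IsNestedOrder.hasListPath (hN : IsNestedOrder G) {v₀ : V} {k t : ℕ}
    (hv₀ : ∀ w, w ≠ v₀ → v₀ < w ∧ G.Adj v₀ w) (hkt : t < k) (hk : k ≤ 2 * t + 3)
    (hcore : ∀ s ≤ t, k - s ≤ (upCore G (s + 1)).card) : HasListPath G k := by
  obtain ⟨j₀, -, hj₀⟩ := Finset.univ.exists_max_image (fun j => (upNbrs G j).card)
    ⟨v₀, Finset.mem_univ _⟩
  have hr : t + 1 ≤ (upNbrs G j₀).card := by
    have h1 := hcore t le_rfl
    obtain ⟨u, hu⟩ := Finset.card_pos.1 (show 0 < (upCore G (t + 1)).card by omega)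
    simp only [upCore, Finset.mem_filter, Finset.mem_univ, true_and] at hu
    obtain ⟨j, -, hj⟩ := hu
    exact hj.trans (hj₀ j (Finset.mem_univ _))
  have hnot : j₀ ∉ upNbrs G j₀ := fun h => (mem_upNbrs.1 h).1.false
  by_cases hbig : k ≤ (upNbrs G j₀).card + 1
  · refine HasListPath.of_le (k' := (insert j₀ (upNbrs G j₀)).card) ?_
      (by rwa [Finset.card_insert_of_notMem hnot])
    refine ⟨(insert j₀ (upNbrs G j₀)).toList, ?_, Finset.nodup_toList _, Finset.length_toList _⟩
    refine isChain_of_pairwise_adj (Finset.nodup_toList _) fun a ha b hb hab => ?_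
    exact hN.adj_of_mem (Finset.mem_toList.1 ha) (Finset.mem_toList.1 hb) hab
  -- Start at the end `j₀` of a longest chain, with `r` ancestors: `t + 1 ≤ r` and `k ≤ 2 * t + 3`
  -- give `k - r - 1 ≤ t + 1 ≤ r`, so the needed cores are available and `T` is large enough.
  refine hN.hasListPath_of_partial (v₀ := v₀) (j₀ := j₀) (n₀ := k - (upNbrs G j₀).card - 1) ?_ ?_
    (k - (upNbrs G j₀).card - 1) le_rfl [j₀] (upNbrs G j₀) (List.isChain_singleton _)
    (List.nodup_singleton _) ?_ ?_ ?_ ?_ ?_ ?_ ?_ ?_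
  · intro j
    rw [Finset.mem_insert]
    by_cases h : v₀ = j
    · exact Or.inl h
    · exact Or.inr (mem_upNbrs.2 (hv₀ j (Ne.symm h)))
  · intro n hn hn'
    have := hcore (n - 1) (by omega)
    rw [Nat.sub_add_cancel hn] at this
    omega
  · intro a ha b hb
    obtain rfl : j₀ = a := by simpa using ha
    exact (mem_upNbrs.1 hb).2.symm
  · intro a ha
    rw [Finset.mem_insert] at ha
    simpa [or_comm] using ha
  · intro a ha
    rw [List.mem_singleton] at ha
    rwa [ha]
  · exact Finset.subset_insert _ _
  · intro a ha haK
    rw [List.mem_singleton] at ha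
    exact absurd (ha ▸ Finset.mem_insert_self _ _) haK
  · intro a ha b hb hba
    rw [Finset.mem_insert] at hb
    rcases hb with rfl | hb
    · exact absurd (mem_upNbrs.1 ha).1 hba.not_gt
    · exact hb
  · omega
  · simp only [List.length_singleton]
    omega

end NestedGraph

/-! ### Comparison of the form with that of `graphW`. -/

section Majorization

variable {n : ℕ} {G : SimpleGraph (Fin n)} {x : Fin n → ℝ} {s m : ℕ}

theorem adjForm_eq_two_mul :
    adjForm G x = 2 * ∑ j, ∑ i ∈ upNbrs G j, x i * x j := by
  classical
  have h1 : ∑ j, ∑ i ∈ upNbrs G j, x i * x j =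
      ∑ j, ∑ i, if i < j ∧ G.Adj i j then x i * x j else 0 := by
    refine Finset.sum_congr rfl fun j _ => ?_
    rw [upNbrs, Finset.sum_filter]
  have h2 : ∑ j, ∑ i ∈ upNbrs G j, x i * x j =
      ∑ j, ∑ i, if j < i ∧ G.Adj i j then x i * x j else 0 := by
    rw [h1, Finset.sum_comm]
    simp only [G.adj_comm, mul_comm]
  rw [two_mul]
  nth_rewrite 1 [h1]
  rw [h2, adjForm_eq_sum, Finset.sum_comm, ← Finset.sum_add_distrib]
  refine Finset.sum_congr rfl fun j _ => ?_
  rw [← Finset.sum_add_distrib]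
  refine Finset.sum_congr rfl fun i _ => ?_
  rcases lt_trichotomy i j with h | rfl | h
  · simp [h, h.not_gt]
  · simp
  · simp [h, h.not_gt]

/-- The vertices before `j` among the first `s` vertices. -/
def initBefore (s : ℕ) (j : Fin n) : Finset (Fin n) := {i | i < j ∧ i.val < s}

/-- The pairs of increasing vertices of index between `a` and `b`. -/
def pairsBetween (n a b : ℕ) : Finset (Fin n × Fin n) :=
  {p | p.1 < p.2 ∧ a ≤ p.1.val ∧ p.2.val < b}

theorem mem_initBefore {i j : Fin n} : i ∈ initBefore s j ↔ i < j ∧ i.val < s := by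
  simp [initBefore]

theorem card_initBefore (j : Fin n) : (initBefore s j).card = min j.val s := by
  have : initBefore s j = ({i | i.val < min j.val s} : Finset (Fin n)) := by
    ext i
    simp only [mem_initBefore, Finset.mem_filter, Finset.mem_univ, true_and, Fin.lt_def, lt_min_iff]
  rw [this, Fin.card_filter_val_lt]
  omega

theorem adjForm_graphW_eq (hms : 2 * s ≤ m) :
    adjForm (graphW n m s) x = 2 * (∑ j, (∑ i ∈ initBefore s j, x i) * x j +
      ∑ p ∈ pairsBetween n s (m - s), x p.1 * x p.2) := by
  classical
  rw [adjForm_eq_two_mul]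
  congr 1
  rw [pairsBetween, Finset.sum_filter, Fintype.sum_prod_type_right, ← Finset.sum_add_distrib]
  refine Finset.sum_congr rfl fun j _ => ?_
  rw [upNbrs, initBefore, Finset.sum_filter, Finset.sum_filter, Finset.sum_mul,
    ← Finset.sum_add_distrib]
  refine Finset.sum_congr rfl fun i _ => ?_
  have h1 : (i < j ∧ (graphW n m s).Adj i j) ↔ i < j ∧ (i.val < s ∨ j.val < m - s) := by
    refine and_congr_right fun hij => ?_
    simp only [graphW, hij.ne, ne_eq, not_false_eq_true, true_and]
    have : i.val < j.val := hij
    omega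
  simp only [h1]
  by_cases hij : i < j <;> by_cases hi : i.val < s <;> by_cases hj : j.val < m - s <;>
    simp [hij, hi, hj, not_le.2, not_lt.1]

/-- Exchange against the threshold `x ⟨s, hs⟩`: entries over `A` outside the initial set are at most
this value, those of the initial set are at least it, and the initial set is no smaller than `A`. -/
theorem sum_le_sum_initBefore (hx : Antitone x) (hx0 : ∀ i, 0 ≤ x i) (hs : s < n) {j : Fin n}
    {A : Finset (Fin n)} (hA : ∀ i ∈ A, i < j) (hAs : A.card ≤ s) :
    ∑ i ∈ A, x i ≤ ∑ i ∈ initBefore s j, x i ∧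
    (∑ i ∈ A, x i = ∑ i ∈ initBefore s j, x i → (∀ i : Fin n, i.val < s → x ⟨s, hs⟩ < x i) →
      initBefore s j ⊆ A) := by
  classical
  set I := initBefore s j with hI
  set a := x ⟨s, hs⟩ with ha
  have hcard : (A \ I).card ≤ (I \ A).card := by
    have h1 : A.card ≤ I.card := by
      rw [hI, card_initBefore]
      refine le_min ?_ hAs
      have h2 : A ⊆ Finset.Iio j := fun i hi => Finset.mem_Iio.2 (hA i hi)
      simpa using Finset.card_le_card h2
    have h3 := Finset.card_sdiff_add_card_inter A I
    have h4 := Finset.card_sdiff_add_card_inter I A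
    rw [Finset.inter_comm] at h4
    omega
  have hle1 : ∑ i ∈ A \ I, x i ≤ (A \ I).card * a := by
    rw [← nsmul_eq_mul]
    refine Finset.sum_le_card_nsmul _ _ _ fun i hi => hx ?_
    rw [Finset.mem_sdiff, hI, mem_initBefore] at hi
    rw [Fin.le_def]
    have := hA i hi.1
    by_contra! h
    exact hi.2 ⟨this, h⟩
  have hle2 : ((I \ A).card : ℝ) * a ≤ ∑ i ∈ I \ A, x i := by
    rw [← nsmul_eq_mul]
    refine Finset.card_nsmul_le_sum _ _ _ fun i hi => hx ?_
    rw [Finset.mem_sdiff, hI, mem_initBefore] at hi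
    exact hi.1.2.le
  have hle3 : ((A \ I).card : ℝ) * a ≤ (I \ A).card * a :=
    mul_le_mul_of_nonneg_right (by exact_mod_cast hcard) (hx0 _)
  have e1 := Finset.sum_inter_add_sum_sdiff A I x
  have e2 := Finset.sum_inter_add_sum_sdiff I A x
  rw [Finset.inter_comm] at e2
  refine ⟨by linarith, fun heq hstrict => ?_⟩
  by_contra hnot
  have hne : (I \ A).Nonempty := by
    rwa [Finset.sdiff_nonempty]
  have hlt : ((I \ A).card : ℝ) * a < ∑ i ∈ I \ A, x i := by
    rw [← nsmul_eq_mul, ← Finset.sum_const]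
    refine Finset.sum_lt_sum_of_nonempty hne fun i hi => hstrict i ?_
    rw [Finset.mem_sdiff, hI, mem_initBefore] at hi
    exact hi.1.2
  linarith

/-- The position of `i` relative to the set `C`. -/
def rankIn (C : Finset (Fin n)) (i : Fin n) : ℕ := (C.filter (· < i)).card

theorem rankIn_le (C : Finset (Fin n)) (i : Fin n) : rankIn C i ≤ i.val := by
  have h : C.filter (· < i) ⊆ Finset.Iio i := fun a ha => by simpa using (Finset.mem_filter.1 ha).2
  simpa [rankIn] using Finset.card_le_card h

theorem rankIn_lt_card {C : Finset (Fin n)} {i : Fin n} (hi : i ∈ C) : rankIn C i < C.card :=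
  Finset.card_lt_card (Finset.filter_ssubset.2 ⟨i, hi, lt_irrefl i⟩)

theorem rankIn_lt {C : Finset (Fin n)} {i j : Fin n} (hi : i ∈ C) (hij : i < j) :
    rankIn C i < rankIn C j := by
  refine Finset.card_lt_card ⟨fun a ha => ?_, fun h => ?_⟩
  · rw [Finset.mem_filter] at *
    exact ⟨ha.1, ha.2.trans hij⟩
  · have := h (Finset.mem_filter.2 ⟨hi, hij⟩)
    exact lt_irrefl i (Finset.mem_filter.1 this).2

theorem rankIn_injOn (C : Finset (Fin n)) : Set.InjOn (rankIn C) C := by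
  intro i hi j hj h
  rcases lt_trichotomy i j with h' | h' | h'
  · exact absurd h (rankIn_lt hi h').ne
  · exact h'
  · exact absurd h (rankIn_lt hj h').ne'

open Classical in
/-- The preceding neighbours of `j`, except, for `j` in the core, those of rank at least `s`. -/
noncomputable def lowNbrs (G : SimpleGraph (Fin n)) (s : ℕ) (j : Fin n) : Finset (Fin n) :=
  (upNbrs G j).filter fun i => j ∈ upCore G (s + 1) → rankIn (upCore G (s + 1)) i < s

open Classical in
/-- The edges inside the core whose first endpoint has rank at least `s`. -/
noncomputable def highPairs (G : SimpleGraph (Fin n)) (s : ℕ) : Finset (Fin n × Fin n) :=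
  {p | p.1 ∈ upNbrs G p.2 ∧ p.2 ∈ upCore G (s + 1) ∧ s ≤ rankIn (upCore G (s + 1)) p.1}

/-- This split mirrors `adjForm_graphW_eq`: low edges are compared with edges meeting `X`, high ones
with edges inside `Y`. -/
theorem adjForm_eq_low_add_high :
    adjForm G x = 2 * (∑ j, (∑ i ∈ lowNbrs G s j, x i) * x j +
      ∑ p ∈ highPairs G s, x p.1 * x p.2) := by
  classical
  rw [adjForm_eq_two_mul]
  congr 1
  rw [highPairs, Finset.sum_filter, Fintype.sum_prod_type_right, ← Finset.sum_add_distrib]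
  refine Finset.sum_congr rfl fun j _ => ?_
  rw [lowNbrs, Finset.sum_mul, ← Finset.sum_filter_add_sum_filter_not (upNbrs G j)
    (fun i => j ∈ upCore G (s + 1) → rankIn (upCore G (s + 1)) i < s)]
  congr 1
  rw [← Finset.sum_filter]
  refine Finset.sum_congr ?_ fun _ _ => rfl
  ext i
  simp only [Finset.mem_filter, Finset.mem_univ, true_and, Classical.not_imp, not_lt]

theorem mem_upCore {l : Fin n} {d : ℕ} :
    l ∈ upCore G d ↔ ∃ j, l ∈ insert j (upNbrs G j) ∧ d ≤ (upNbrs G j).card := by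
  simp only [upCore, Finset.mem_filter, Finset.mem_univ, true_and]

theorem IsNestedOrder.mem_upCore_of_mem_upNbrs (hN : IsNestedOrder G) {i j : Fin n} {d : ℕ}
    (hj : j ∈ upCore G d) (hi : i ∈ upNbrs G j) : i ∈ upCore G d := by
  obtain ⟨a, ha, hd⟩ := mem_upCore.1 hj
  exact mem_upCore.2 ⟨a, hN.mem_of_mem_upNbrs ha hi, hd⟩

/-- In the core, ranks below `s` are distinct; a vertex outside the core has at most `s` preceding
neighbours by definition. -/
theorem IsNestedOrder.card_lowNbrs_le (hN : IsNestedOrder G) (j : Fin n) :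
    (lowNbrs G s j).card ≤ s := by
  classical
  by_cases hj : j ∈ upCore G (s + 1)
  · refine (Finset.card_le_card_of_injOn (t := Finset.range s) (rankIn (upCore G (s + 1))) ?_ ?_).trans_eq (Finset.card_range s)
    · intro i hi
      have := (Finset.mem_filter.1 hi).2 hj
      simpa using this
    · intro a ha b hb h
      exact rankIn_injOn _ (hN.mem_upCore_of_mem_upNbrs hj (Finset.mem_filter.1 ha).1)
        (hN.mem_upCore_of_mem_upNbrs hj (Finset.mem_filter.1 hb).1) h
  · refine (Finset.card_filter_le _ _).trans ?_
    by_contra! h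
    exact hj (mem_upCore.2 ⟨j, Finset.mem_insert_self _ _, h⟩)

theorem IsNestedOrder.sum_lowNbrs_le (hN : IsNestedOrder G) (hx : Antitone x) (hx0 : ∀ i, 0 ≤ x i)
    (hs : s < n) (j : Fin n) :
    ∑ i ∈ lowNbrs G s j, x i ≤ ∑ i ∈ initBefore s j, x i ∧
    (∑ i ∈ lowNbrs G s j, x i = ∑ i ∈ initBefore s j, x i →
      (∀ i : Fin n, i.val < s → x ⟨s, hs⟩ < x i) → initBefore s j ⊆ lowNbrs G s j) :=
  sum_le_sum_initBefore hx hx0 hs (fun _ hi => (mem_upNbrs.1 (Finset.mem_filter.1 hi).1).1)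
    (hN.card_lowNbrs_le j)

/-- Ranking pushes the core injectively onto an initial segment of length at most `m - s`. Indices
do not increase, so the products do not decrease. -/
theorem IsNestedOrder.sum_highPairs_le (hN : IsNestedOrder G) (hx : Antitone x)
    (hx0 : ∀ i, 0 ≤ x i) (hC : (upCore G (s + 1)).card ≤ m - s) :
    ∑ p ∈ highPairs G s, x p.1 * x p.2 ≤ ∑ p ∈ pairsBetween n s (m - s), x p.1 * x p.2 := by
  classical
  set C := upCore G (s + 1) with hCdef
  let r : Fin n → Fin n := fun i => ⟨rankIn C i, (rankIn_le C i).trans_lt i.isLt⟩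
  have hr : ∀ i, r i ≤ i := fun i => rankIn_le C i
  have hmem : ∀ p ∈ highPairs G s, p.1 ∈ C ∧ p.2 ∈ C ∧ p.1 < p.2 ∧ s ≤ rankIn C p.1 := by
    intro p hp
    simp only [highPairs, Finset.mem_filter, Finset.mem_univ, true_and] at hp
    exact ⟨hN.mem_upCore_of_mem_upNbrs hp.2.1 hp.1, hp.2.1, (mem_upNbrs.1 hp.1).1, hp.2.2⟩
  have hrinj : ∀ a ∈ C, ∀ b ∈ C, r a = r b → a = b := fun a ha b hb h =>
    rankIn_injOn C ha hb (congrArg Fin.val h)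
  calc ∑ p ∈ highPairs G s, x p.1 * x p.2
      ≤ ∑ p ∈ highPairs G s, x (r p.1) * x (r p.2) := by
        refine Finset.sum_le_sum fun p _ => ?_
        exact mul_le_mul (hx (hr _)) (hx (hr _)) (hx0 _) (hx0 _)
    _ = ∑ p ∈ (highPairs G s).image fun p => (r p.1, r p.2), x p.1 * x p.2 := by
        rw [Finset.sum_image]
        intro p hp q hq h
        obtain ⟨h1, h2⟩ := Prod.mk.inj h
        have hp' := hmem p hp
        have hq' := hmem q hq
        exact Prod.ext (hrinj _ hp'.1 _ hq'.1 h1) (hrinj _ hp'.2.1 _ hq'.2.1 h2)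
    _ ≤ _ := by
        refine Finset.sum_le_sum_of_subset_of_nonneg ?_ fun p _ _ => mul_nonneg (hx0 _) (hx0 _)
        intro q hq
        obtain ⟨p, hp, rfl⟩ := Finset.mem_image.1 hq
        obtain ⟨h1, h2, h3, h4⟩ := hmem p hp
        simp only [pairsBetween, Finset.mem_filter, Finset.mem_univ, true_and]
        exact ⟨rankIn_lt h1 h3, h4, (rankIn_lt_card h2).trans_le hC⟩

/-- If the core of level `s` has at most `m - s` vertices, then the quadratic form is bounded by
that of `graphW n m s`. -/
theorem IsNestedOrder.adjForm_le (hN : IsNestedOrder G) (hx : Antitone x) (hx0 : ∀ i, 0 ≤ x i)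
    (hs : s < n) (hms : 2 * s ≤ m) (hC : (upCore G (s + 1)).card ≤ m - s) :
    adjForm G x ≤ adjForm (graphW n m s) x := by
  rw [adjForm_graphW_eq hms, adjForm_eq_low_add_high (s := s)]
  refine mul_le_mul_of_nonneg_left (add_le_add (Finset.sum_le_sum fun j _ => ?_)
    (hN.sum_highPairs_le hx hx0 hC)) zero_le_two
  exact mul_le_mul_of_nonneg_right (hN.sum_lowNbrs_le hx hx0 hs j).1 (hx0 j)

end Majorization

/-! ### The case of equality. -/

section Equality

variable {n : ℕ} {G : SimpleGraph (Fin n)} {x : Fin n → ℝ} {m t : ℕ} {μ : ℝ}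

/-- The entries of an eigenvector of `graphW n m t` at `X` exceed the other ones. -/
theorem lt_of_nbrSum_graphW (hpos : ∀ i, 0 < x i) (hμ : 0 ≤ μ)
    (hmt : 2 * t + 1 ≤ m) (hn : m - t < n)
    (heig : ∀ i, nbrSum (graphW n m t) x i = μ * x i) (ht : t < n) (i : Fin n) (hi : i.val < t) :
    x ⟨t, ht⟩ < x i := by
  have h1 := heig i
  have h2 := heig ⟨t, ht⟩
  rw [nbrSum_graphW_of_lt x (by omega) hi] at h1
  rw [nbrSum_graphW_of_mem_middle x (i := ⟨t, ht⟩) le_rfl (by simp only; omega)] at h2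
  have h3 : (∑ j : Fin n, if j.val < m - t then x j else 0) < ∑ j, x j := by
    refine Finset.sum_lt_sum (fun j _ => ?_) ⟨⟨m - t, hn⟩, Finset.mem_univ _, ?_⟩
    · split_ifs
      exacts [le_rfl, (hpos j).le]
    · simpa using hpos _
  nlinarith

/-- Equality in `IsNestedOrder.adjForm_le` forces equality in both of its parts. -/
theorem IsNestedOrder.adj_of_adjForm_eq (hN : IsNestedOrder G) (hx : Antitone x)
    (hpos : ∀ i, 0 < x i) (ht : t < n) (hms : 2 * t ≤ m)
    (hC : (upCore G (t + 1)).card ≤ m - t) (heq : adjForm G x = adjForm (graphW n m t) x)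
    (hstrict : ∀ i : Fin n, i.val < t → x ⟨t, ht⟩ < x i) :
    (∀ j, initBefore t j ⊆ lowNbrs G t j) ∧
      ∑ p ∈ highPairs G t, x p.1 * x p.2 = ∑ p ∈ pairsBetween n t (m - t), x p.1 * x p.2 := by
  have hx0 : ∀ i, 0 ≤ x i := fun i => (hpos i).le
  rw [adjForm_graphW_eq hms, adjForm_eq_low_add_high (s := t)] at heq
  have h1 : ∀ j ∈ Finset.univ, (∑ i ∈ lowNbrs G t j, x i) * x j ≤
      (∑ i ∈ initBefore t j, x i) * x j := fun j _ =>
    mul_le_mul_of_nonneg_right (hN.sum_lowNbrs_le hx hx0 ht j).1 (hx0 j)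
  have h2 := hN.sum_highPairs_le hx hx0 hC
  have h3 := Finset.sum_le_sum h1
  have h4 : ∑ j, (∑ i ∈ lowNbrs G t j, x i) * x j = ∑ j, (∑ i ∈ initBefore t j, x i) * x j := by
    linarith
  refine ⟨fun j => (hN.sum_lowNbrs_le hx hx0 ht j).2 ?_ hstrict, by linarith⟩
  exact mul_right_cancel₀ (hpos j).ne' ((Finset.sum_eq_sum_iff_of_le h1).1 h4 j (Finset.mem_univ j))

/-- The chain of inequalities collapses, so `x` is also an eigenvector of `graphW n m t` and every
vertex keeps its edges to `X`. Since `|Y| ≤ 2`, at most one edge remains to be located, and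
comparison of the high parts places it in `Y`. -/
theorem IsNestedOrder.eq_graphW (hN : IsNestedOrder G) (hx : Antitone x)
    (hpos : ∀ i, 0 < x i) (hμ : 0 ≤ μ) (hmt : 2 * t + 1 ≤ m) (hmt' : m ≤ 2 * t + 2)
    (hn : m < n) (hC : (upCore G (t + 1)).card ≤ m - t)
    (hW : ∀ z : Fin n → ℝ, adjForm (graphW n m t) z ≤ μ * ∑ i, z i ^ 2)
    (hG : μ * ∑ i, x i ^ 2 ≤ adjForm G x) : G = graphW n m t := by
  classical
  have hx0 : ∀ i, 0 ≤ x i := fun i => (hpos i).le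
  have ht : t < n := by omega
  have hle := hN.adjForm_le hx hx0 ht (by omega) hC
  have heig := nbrSum_eq_of_adjForm_max hW (hG.trans hle)
  obtain ⟨hlow, hhigh⟩ := hN.adj_of_adjForm_eq hx hpos ht (by omega) hC
    (le_antisymm hle ((hW x).trans hG))
    (lt_of_nbrSum_graphW hpos hμ hmt (by omega) heig ht)
  set C := upCore G (t + 1) with hCdef
  have hup : ∀ j, initBefore t j ⊆ upNbrs G j := fun j =>
    (hlow j).trans (Finset.filter_subset _ _)
  -- an edge outside `X` lies in the core, which it exhausts together with `X`
  have hedge : ∀ i j : Fin n, i < j → G.Adj i j → t ≤ i.val →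
      (i, j) ∈ highPairs G t ∧ m = 2 * t + 2 ∧
        ∀ a b : Fin n, a ∈ C → b ∈ C → t ≤ a.val → a < b → a = i ∧ b = j := by
    intro i j hij hadj hti
    have hiup : i ∈ upNbrs G j := mem_upNbrs.2 ⟨hij, hadj⟩
    have hti' : t ≤ j.val := hti.trans (Fin.le_def.1 hij.le)
    have heq : initBefore t j = lowNbrs G t j := by
      refine Finset.eq_of_subset_of_card_le (hlow j) ?_
      rw [card_initBefore, min_eq_right hti']
      exact hN.card_lowNbrs_le j
    have hnot : i ∉ lowNbrs G t j := by
      rw [← heq, mem_initBefore]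
      omega
    have hhp : (i, j) ∈ highPairs G t := by
      simp only [lowNbrs, Finset.mem_filter, not_and, Classical.not_imp, not_lt] at hnot
      simp only [highPairs, Finset.mem_filter, Finset.mem_univ, true_and]
      exact ⟨hiup, hnot hiup⟩
    have hjC : j ∈ C := by
      simp only [highPairs, Finset.mem_filter, Finset.mem_univ, true_and] at hhp
      exact hhp.2.1
    have hiC : i ∈ C := hN.mem_upCore_of_mem_upNbrs hjC hiup
    have hinit : initBefore t j ⊆ C := fun a ha => hN.mem_upCore_of_mem_upNbrs hjC (hup j ha)
    have hsub : insert i (insert j (initBefore t j)) ⊆ C :=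
      Finset.insert_subset hiC (Finset.insert_subset hjC hinit)
    have hj0 : j ∉ initBefore t j := by
      rw [mem_initBefore]; omega
    have hi0 : i ∉ insert j (initBefore t j) := by
      rw [Finset.mem_insert, mem_initBefore, not_or]
      exact ⟨hij.ne, by omega⟩
    have hcard : (insert i (insert j (initBefore t j))).card = t + 2 := by
      rw [Finset.card_insert_of_notMem hi0, Finset.card_insert_of_notMem hj0, card_initBefore,
        min_eq_right hti']
    have hcard' := Finset.card_le_card hsub
    have hm : m = 2 * t + 2 := by omega
    have hCeq : insert i (insert j (initBefore t j)) = C :=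
      Finset.eq_of_subset_of_card_le hsub (by omega)
    refine ⟨hhp, hm, fun a b ha hb hta hab => ?_⟩
    rw [← hCeq, Finset.mem_insert, Finset.mem_insert, mem_initBefore] at ha hb
    have hab' : a.val < b.val := hab
    have hij' : i.val < j.val := hij
    simp only [Fin.ext_iff] at ha hb ⊢
    omega
  -- if `Y` has two vertices, then they are adjacent
  have hY : m = 2 * t + 2 → ∀ i j : Fin n, i.val = t → j.val = t + 1 →
      (i, j) ∈ highPairs G t := by
    intro hm i j hi hj
    have hpairs : pairsBetween n t (m - t) = {(i, j)} := by
      ext ⟨a, b⟩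
      simp only [pairsBetween, Finset.mem_filter, Finset.mem_univ, true_and,
        Finset.mem_singleton, Prod.mk.injEq, Fin.lt_def, Fin.ext_iff]
      omega
    rw [hpairs, Finset.sum_singleton] at hhigh
    have hne : (highPairs G t).Nonempty := by
      by_contra h
      rw [Finset.not_nonempty_iff_eq_empty] at h
      rw [h, Finset.sum_empty] at hhigh
      exact (mul_pos (hpos i) (hpos j)).ne hhigh
    have hmem : ∀ p ∈ highPairs G t, p.1 < p.2 ∧ G.Adj p.1 p.2 ∧ t ≤ p.1.val ∧
        p.1 ∈ C ∧ p.2 ∈ C := by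
      intro p hp
      simp only [highPairs, Finset.mem_filter, Finset.mem_univ, true_and] at hp
      have h1 := mem_upNbrs.1 hp.1
      exact ⟨h1.1, h1.2, hp.2.2.trans (rankIn_le _ _),
        hN.mem_upCore_of_mem_upNbrs hp.2.1 hp.1, hp.2.1⟩
    obtain ⟨⟨a, b⟩, hab⟩ := hne
    obtain ⟨h1, h2, h3, -, -⟩ := hmem _ hab
    simp only at h1 h2 h3
    have hsingle : highPairs G t = {(a, b)} := by
      refine Finset.eq_singleton_iff_unique_mem.2 ⟨hab, fun p hp => ?_⟩
      obtain ⟨g1, -, g3, g4, g5⟩ := hmem p hp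
      obtain ⟨e1, e2⟩ := (hedge a b h1 h2 h3).2.2 p.1 p.2 g4 g5 g3 g1
      exact Prod.ext e1 e2
    rw [hsingle, Finset.sum_singleton] at hhigh
    simp only at hhigh
    have hia : i ≤ a := by rw [Fin.le_def]; omega
    have h1' : a.val < b.val := h1
    -- Otherwise `b` lies in `Z`, where the eigenvector is strictly smaller than on `Y`, so `x a * x
    -- b < x i * x j`.
    have hbj : b = j := by
      by_contra hne
      have hb : t + 2 ≤ b.val := by
        rw [Fin.ext_iff] at hne
        omega
      have e1 := heig j
      have e2 := heig b
      rw [nbrSum_graphW_of_mem_middle x (by omega) (by omega)] at e1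
      rw [nbrSum_graphW_of_ge x (by omega) (by omega)] at e2
      have e3 : (∑ l : Fin n, if l.val < t then x l else 0) + x i + x j ≤
          ∑ l : Fin n, if l.val < m - t then x l else 0 := by
        have hij : i ≠ j := fun h => by rw [h] at hi; omega
        have e4 : x i + x j = ∑ l : Fin n, if l = i ∨ l = j then x l else 0 := by
          rw [← Finset.sum_filter, Finset.filter_or, Finset.filter_eq', Finset.filter_eq']
          simp only [Finset.mem_univ, if_true]
          rw [← Finset.insert_eq, Finset.sum_pair hij]
        rw [add_assoc, e4, ← Finset.sum_add_distrib]
        refine Finset.sum_le_sum fun l _ => ?_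
        have hl := hx0 l
        by_cases hlt : l.val < t
        · have g1 : ¬ (l = i ∨ l = j) := by simp only [Fin.ext_iff]; omega
          have g2 : l.val < m - t := by omega
          simp [hlt, g1, g2]
        · by_cases g : l = i ∨ l = j
          · have g2 : l.val < m - t := by simp only [Fin.ext_iff] at g; omega
            simp [hlt, g, g2]
          · simp only [hlt, g, if_false, add_zero]
            split_ifs
            exacts [hl, le_rfl]
      have e5 : μ * x b < μ * x j := by
        have := hpos i
        linarith
      have e6 : x b < x j := lt_of_mul_lt_mul_left e5 hμ
      have e7 : x a ≤ x i := hx hia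
      have e8 := mul_le_mul_of_nonneg_right e7 (hx0 b)
      have e9 := mul_lt_mul_of_pos_left e6 (hpos i)
      linarith
    have hai : a = i := by
      rw [Fin.ext_iff] at hbj ⊢
      omega
    rw [← hai, ← hbj]
    exact hab
  have hmain : ∀ i j : Fin n, i < j → (G.Adj i j ↔ (graphW n m t).Adj i j) := by
    intro i j hij
    have hij' : i.val < j.val := hij
    have hWadj : (graphW n m t).Adj i j ↔ (i.val < t ∨ j.val < m - t) := by
      simp only [graphW, hij.ne, ne_eq, not_false_eq_true, true_and]
      omega
    rw [hWadj]
    constructor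
    · intro hadj
      by_contra! hnot
      obtain ⟨-, hm, hall⟩ := hedge i j hij hadj hnot.1
      have hmem := hY hm ⟨t, ht⟩ ⟨t + 1, by omega⟩ rfl rfl
      simp only [highPairs, Finset.mem_filter, Finset.mem_univ, true_and] at hmem
      obtain ⟨-, h2⟩ := hall ⟨t, ht⟩ ⟨t + 1, by omega⟩
        (hN.mem_upCore_of_mem_upNbrs hmem.2.1 hmem.1) hmem.2.1 le_rfl
        (by rw [Fin.lt_def]; simp)
      rw [Fin.ext_iff] at h2
      simp only at h2
      omega
    · intro h
      by_cases hi : i.val < t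
      · exact (mem_upNbrs.1 (hup j (mem_initBefore.2 ⟨hij, hi⟩))).2
      · have hmem := hY (by omega) i j (by omega) (by omega)
        simp only [highPairs, Finset.mem_filter, Finset.mem_univ, true_and] at hmem
        exact (mem_upNbrs.1 hmem.1).2
  ext i j
  rcases lt_trichotomy i j with h | rfl | h
  · exact hmain i j h
  · simp
  · rw [G.adj_comm, (graphW n m t).adj_comm]
    exact hmain j i h

end Equality

/-! ### Assembly of the proof. -/

section Main

theorem adjForm_comap {V W : Type*} [Fintype V] [Fintype W] (G : SimpleGraph V) (e : W ≃ V)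
    (x : V → ℝ) : adjForm (G.comap e) (x ∘ e) = adjForm G x := by
  classical
  simp only [adjForm_eq_sum, SimpleGraph.comap_adj, Function.comp_apply]
  rw [← e.sum_comp]
  refine Finset.sum_congr rfl fun i _ => ?_
  rw [← e.sum_comp]

theorem HasListPath.of_comap {V W : Type*} {G : SimpleGraph V} {f : W → V}
    (hf : Function.Injective f) {k : ℕ} (h : HasListPath (G.comap f) k) : HasListPath G k := by
  obtain ⟨l, hc, hn, hl⟩ := h
  exact ⟨l.map f, (List.isChain_map f).2 hc, hn.map hf, by simpa using hl⟩

theorem exists_equiv_antitone {V : Type*} [Fintype V] {n : ℕ} (hV : Fintype.card V = n)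
    (x : V → ℝ) : ∃ e : Fin n ≃ V, Antitone (x ∘ e) := by
  let e₀ : Fin n ≃ V := (Fintype.equivFinOfCardEq hV).symm
  let f : Fin n → ℝ := fun i => - x (e₀ i)
  refine ⟨(Tuple.sort f).trans e₀, fun i j hij => ?_⟩
  have := Tuple.monotone_sort f hij
  simp only [f, Function.comp_apply, neg_le_neg_iff] at this
  exact this

/-- A path-free graph in nested order, with a dominating first vertex, is `graphW` if its
quadratic form is large at a positive antitone vector. -/
theorem IsNestedOrder.eq_graphW_of_not_hasListPath {n k : ℕ} {μ : ℝ} {G : SimpleGraph (Fin n)}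
    {x : Fin n → ℝ} (hN : IsNestedOrder G) (hx : Antitone x) (hpos : ∀ i, 0 < x i) {v₀ : Fin n}
    (hv₀ : ∀ w, w ≠ v₀ → v₀ < w ∧ G.Adj v₀ w) (hk : 4 ≤ k) (hn : 3 * k ≤ n)
    (hμ : ((k - 1 : ℕ) : ℝ) - 1 < μ) (hlevel : levelW n (k - 1) (k / 2 - 1) μ = μ)
    (hG : ¬ HasListPath G k) (hxG : μ * ∑ i, x i ^ 2 ≤ adjForm G x) :
    G = graphW n (k - 1) (k / 2 - 1) ∧ adjForm G x ≤ μ * ∑ i, x i ^ 2 := by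
  have hμ0 : 0 ≤ μ := by
    have : (1 : ℝ) ≤ ((k - 1 : ℕ) : ℝ) := by exact_mod_cast (show 1 ≤ k - 1 by omega)
    linarith
  obtain ⟨s, hst, hs⟩ : ∃ s ≤ k / 2 - 1, (upCore G (s + 1)).card < k - s := by
    by_contra! h
    exact hG (hN.hasListPath hv₀ (by omega) (by omega) h)
  -- The dominating vertex precedes every other one, so the core for `s = 0` is the whole vertex
  -- set.
  have hs1 : 1 ≤ s := by
    by_contra! h0
    obtain rfl : s = 0 := by omega
    have huniv : upCore G (0 + 1) = Finset.univ := by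
      refine Finset.eq_univ_of_forall fun l => mem_upCore.2 ?_
      have key : ∀ w, w ≠ v₀ → v₀ ∈ upNbrs G w := fun w hw => mem_upNbrs.2 (hv₀ w hw)
      by_cases hl : l = v₀
      · have : Nontrivial (Fin n) := Fin.nontrivial_iff_two_le.2 (by omega)
        obtain ⟨w, hw⟩ := exists_ne v₀
        exact ⟨w, hl ▸ Finset.mem_insert_of_mem (key w hw), Finset.card_pos.2 ⟨_, key w hw⟩⟩
      · exact ⟨l, Finset.mem_insert_self _ _, Finset.card_pos.2 ⟨_, key l hl⟩⟩
    rw [huniv, Finset.card_univ, Fintype.card_fin] at hs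
    omega
  have hle := hN.adjForm_le hx (fun i => (hpos i).le) (show s < n by omega)
    (show 2 * s ≤ k - 1 by omega) (by omega)
  rcases hst.lt_or_eq with hlt | rfl
  · exfalso
    have hlev := levelW_lt (n := n) hlt (show 1 ≤ k - 1 by omega) (by omega) hμ
    rw [hlevel] at hlev
    have hw0 : ∀ i : ℕ, i < s → weightW (k - 1) s μ i = 1 := fun i hi => if_pos hi
    have hlt' := adjForm_lt_of_supersolution (G := graphW n (k - 1) s) (M := μ) (x := x)
      (y := fun i : Fin n => weightW (k - 1) s μ i)
      (fun i => weightW_pos hs1 (by omega) hμ i) (fun i => ?_) (i₀ := ⟨0, by omega⟩) ?_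
      (hpos _).ne'
    · linarith
    · rw [nbrSum_weightW (by omega) (by omega) (by omega) hμ]
      split_ifs with hi
      · rw [hw0 _ hi, mul_one]
        exact hlev.le
      · exact le_rfl
    · rw [nbrSum_weightW (by omega) (by omega) (by omega) hμ, if_pos (by simp only; omega),
        hw0 _ (by simp only; omega), mul_one]
      exact hlev
  · have hW : ∀ z : Fin n → ℝ, adjForm (graphW n (k - 1) (k / 2 - 1)) z ≤ μ * ∑ i, z i ^ 2 := by
      intro z
      refine adjForm_le_of_supersolution (y := fun i : Fin n => weightW (k - 1) (k / 2 - 1) μ i)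
        (fun i => weightW_pos hs1 (by omega) hμ i) fun i => ?_
      rw [nbrSum_weightW (by omega) (by omega) (by omega) hμ]
      split_ifs with hi
      · rw [hlevel, weightW, if_pos hi, mul_one]
      · exact le_rfl
    exact ⟨hN.eq_graphW hx hpos hμ0 (by omega) (by omega) (by omega) (by omega) hW hxG,
      hle.trans (hW x)⟩

/-- A path-free graph whose leading eigenvalue is maximum and at least `μ` is `graphW`. -/
theorem nonempty_iso_graphW_of_max {V : Type*} [Fintype V] {n k : ℕ} {μ M : ℝ}
    (hV : Fintype.card V = n) (hk : 4 ≤ k) (hn : 3 * k ≤ n) (hμ : ((k - 1 : ℕ) : ℝ) - 1 < μ)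
    (hlevel : levelW n (k - 1) (k / 2 - 1) μ = μ) (hμM : μ ≤ M) {G : SimpleGraph V} {x : V → ℝ}
    (hx : ∀ i, 0 ≤ x i) (hx0 : x ≠ 0)
    (hmax : ∀ H : SimpleGraph V, ¬ HasListPath H k → ∀ z : V → ℝ, adjForm H z ≤ M * ∑ i, z i ^ 2)
    (hG : ¬ HasListPath G k) (hxG : adjForm G x = M * ∑ i, x i ^ 2) :
    Nonempty (G ≃g graphW n (k - 1) (k / 2 - 1)) ∧ M ≤ μ := by
  have hkM : (k : ℝ) - 2 < M := by
    rw [Nat.cast_sub (by omega), Nat.cast_one] at hμ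
    linarith
  obtain ⟨hpos, v, hvmax, hvdom⟩ := exists_dominating hkM hx hx0 hmax hG hxG
  obtain ⟨e, he⟩ := exists_equiv_antitone hV x
  have hsum : ∑ i, (x ∘ e) i ^ 2 = ∑ i, x i ^ 2 := e.sum_comp fun i => x i ^ 2
  have hspos : 0 < ∑ i, x i ^ 2 :=
    Finset.sum_pos (fun i _ => pow_pos (hpos i) 2) ⟨v, Finset.mem_univ _⟩
  have hN : IsNestedOrder (G.comap e) := by
    intro i j l hij hadj hjl hli
    exact adj_of_adj_of_le hx hmax hG hxG hadj.symm (he hij.le) (hpos _) hjl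
      (fun h => hli (e.injective h))
  have h0 : 0 < n := by omega
  have hv₀ : ∀ w, w ≠ (⟨0, h0⟩ : Fin n) → ⟨0, h0⟩ < w ∧ (G.comap e).Adj ⟨0, h0⟩ w := by
    intro w hw
    refine ⟨lt_of_le_of_ne (Nat.zero_le _) hw.symm, ?_⟩
    rw [SimpleGraph.comap_adj]
    have hew : e w ≠ e ⟨0, h0⟩ := fun h => hw (e.injective h)
    -- If the first vertex is not `v`, it is adjacent to `v` and its entry is at least as large, so
    -- it inherits the neighbours of `v`.
    by_cases hv : e ⟨0, h0⟩ = v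
    · rw [hv] at hew ⊢
      exact hvdom _ hew
    · have hge : x v ≤ x (e ⟨0, h0⟩) := by
        have := he (show (⟨0, h0⟩ : Fin n) ≤ e.symm v from Nat.zero_le _)
        simpa using this
      by_cases hwv : e w = v
      · rw [hwv]
        exact (hvdom _ hv).symm
      · exact adj_of_adj_of_le hx hmax hG hxG (hvdom _ hv) hge (hpos _) (hvdom _ hwv) hew
  have hform : adjForm (G.comap e) (x ∘ e) = M * ∑ i, (x ∘ e) i ^ 2 := by
    rw [adjForm_comap, hsum, hxG]
  obtain ⟨heq, hle⟩ := hN.eq_graphW_of_not_hasListPath he (fun i => hpos _) hv₀ hk hn hμ hlevel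
    (fun h => hG (h.of_comap e.injective))
    (by rw [hform]; exact mul_le_mul_of_nonneg_right hμM (by rw [hsum]; exact hspos.le))
  refine ⟨⟨(SimpleGraph.Iso.comap e G).symm.trans ?_⟩, ?_⟩
  · rw [heq]
  · rw [hform, hsum] at hle
    exact le_of_mul_le_mul_right hle hspos

theorem containsPathOfOrder_two {V : Type*} [Fintype V] {G : SimpleGraph V} {n : ℕ}
    (hV : Fintype.card V = n) (hiso : ¬ Nonempty (G ≃g graphW n 1 0)) :
    ContainsPathOfOrder G 2 := by
  by_contra hnot
  have hG : ∀ a b, ¬ G.Adj a b := fun a b hab => hnot <|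
    HasListPath.containsPathOfOrder two_ne_zero
      ⟨[a, b], List.isChain_pair.2 hab, by simpa using hab.ne, rfl⟩
  refine hiso ⟨⟨Fintype.equivFinOfCardEq hV, fun {a b} => ?_⟩⟩
  refine iff_of_false ?_ (hG a b)
  rintro ⟨hne, h⟩
  refine hne (Fin.ext ?_)
  omega

end Main

theorem theorem4p10 {V : Type*} [Fintype V] (G : SimpleGraph V) (n k : ℕ)
    (hk : 2 ≤ k) (hk3 : k ≠ 3) (hV : Fintype.card V = n) (hn : 3 * k ≤ n)
    (hG : graphSpectralRadius (graphW n (k - 1) (k / 2 - 1)) ≤ graphSpectralRadius G)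
    (hiso : ¬ Nonempty (G ≃g graphW n (k - 1) (k / 2 - 1))) :
    ContainsPathOfOrder G k := by
  obtain rfl | hk4 : k = 2 ∨ 4 ≤ k := by omega
  · exact containsPathOfOrder_two hV hiso
  by_contra hnot
  have hfree : ¬ HasListPath G k := fun h => hnot (h.containsPathOfOrder (by omega))
  have : Nonempty V := Fintype.card_pos_iff.1 (by omega)
  obtain ⟨μ, hμ, hlevel⟩ := exists_levelW_eq (n := n) (m := k - 1) (t := k / 2 - 1) (by omega)
    (by omega) (by omega) (by omega)
  have hμ0 : 0 < μ := by
    have : (1 : ℝ) ≤ ((k - 1 : ℕ) : ℝ) := by exact_mod_cast (show 1 ≤ k - 1 by omega)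
    linarith
  choose M x hx0 hx hform hmax using fun H : SimpleGraph V => exists_adjForm_max H
  have hμG : μ ≤ M G := by
    have hpos := fun i : ℕ => weightW_pos (s := k / 2 - 1) (m := k - 1) (by omega) (by omega) hμ i
    have h1 : ENNReal.ofReal μ ≤ graphSpectralRadius (graphW n (k - 1) (k / 2 - 1)) := by
      refine le_graphSpectralRadius (y := fun i : Fin n => weightW (k - 1) (k / 2 - 1) μ i)
        (fun h => ?_) fun i => ?_
      · exact (hpos 0).ne' (congrFun h (⟨0, by omega⟩ : Fin n))
      · rw [nbrSum_weightW (by omega) (by omega) (by omega) hμ]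
        split_ifs with hi
        · rw [hlevel, weightW, if_pos hi, mul_one]
        · rfl
    have h2 := (h1.trans hG).trans (graphSpectralRadius_le (hmax G))
    by_contra! hlt
    exact absurd h2 (not_le.2 ((ENNReal.ofReal_lt_ofReal_iff hμ0).2 hlt))
  obtain ⟨H, hH, hHmax⟩ := Set.exists_max_image {H : SimpleGraph V | ¬ HasListPath H k} M
    (Set.toFinite _) ⟨G, hfree⟩
  have hle : ∀ H' : SimpleGraph V, ¬ HasListPath H' k →
      ∀ z : V → ℝ, adjForm H' z ≤ M H * ∑ i, z i ^ 2 := fun H' hH' z =>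
    (hmax H' z).trans (mul_le_mul_of_nonneg_right (hHmax H' hH')
      (Finset.sum_nonneg fun i _ => sq_nonneg _))
  have hHμ : M H ≤ μ := (nonempty_iso_graphW_of_max hV hk4 hn hμ hlevel
    (hμG.trans (hHmax G hfree)) (hx H) (hx0 H) hle hH (hform H)).2
  -- Thus `G` is itself extremal, and the structure result applies to it.
  have hMG : M G = M H := le_antisymm (hHmax G hfree) (hHμ.trans hμG)
  exact hiso (nonempty_iso_graphW_of_max hV hk4 hn hμ hlevel hμG (hx G) (hx0 G)
    (hMG ▸ hle) hfree (hform G)).1
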